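/- **Setting.** A point $p\in\mathbb{R}^2$ *dominates* $q$ if $p_x>q_x$ and $p_y>q_y$; it dominates a region if it dominates all of its points. Let $F^0=(R_1,\dots,R_n)$ be closed axis-aligned rectangles of positive width and height (possibly overlapping). A realization $P\sim F$ of a family $F=(S_i)_i$ of regions chooses $p_i\in S_i$ for each $i$. Retrieving the regions in $A$ replaces $R_i$ by $\{p_i\}$ for each $i\in A$; the result is written $F^0\odot_P A$. The Pareto front $\mathrm{PF}(P)$ consists of the points of $P$ that no point of $P$ dominates, with the order $a\prec b$ iff $p_a,p_b\in\mathrm{PF}(P)$ and $p_a$ is strictly left of or strictly above $p_b$. A family is *finished* if all its realizations induce the same relation $\prec$. Let $r(F^0,P)$ be the minimum of $|A|$ over all $A$ such that $F^0\odot_P A$ is finished. The outer Pareto front $\mathrm{OPF}(F)$ consists of the regions of $F$ containing a point not dominated by any point of another region of $F$; its staircase is the boundary of the set of points not dominated by any point of a region of $\mathrm{OPF}(F)$. The inner Pareto front $\mathrm{IPF}(F)$ is the set of points $z$ such that in every realization of $F$ some point dominates $z$. A region of $F$ is *dominated in $F$* if its point is on the Pareto front of no realization of $F$. We assume that no $R_i$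 is contained in $\mathrm{IPF}(F^0)$. $R_a$ has an *outgoing dependency* to $R_b$ ($b\ne a$) if there is $q\in R_b\setminus \mathrm{IPF}(F^0)$ such that the top-right corner of $R_b$ does not dominate $R_a$, and $q\in R_a$ or the top-right corner of $R_a$ dominates $q$. Let $I^0$ be the set of (*independent*) regions without outgoing dependency. The *layers* $F_1,\dots,F_k$ partition $F^0-I^0$: $F_i$ consists of the regions of $\mathrm{OPF}\big((F^0-I^0)-\bigcup_{j<i}F_j\big)$, as long as this is non-empty. Below, $F$ is the current state of the family $F^0-I^0$ (retrieved regions are replaced by their points), and the *active layer* $L_i(F)$ consists of the regions of $F_i$ that are neither retrieved nor dominated in $F$. **Layered strategy.** 1. For $i=1,\dots,k$: while $L_i(F)\neq\emptyset$, retrieve any region of $L_i(F)$. 2. For each $R_a\in I^0$, in any order: if the interior, the (closed) top facet or the (closed) right facet of $R_a$ intersects the staircase of $\mathrm{OPF}(F)$, retrieve $R_a$. 3. For each retrieved point $p_i\in\mathrm{OPF}(F)$, in any order: retrieve each unretrieved $R_a\in I^0$ that is hit by the closed upward ray from $p_i$ in a first point other than its bottom-right corner, and each unretrieved $R_a\in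 I^0$ that is hit by the closed rightward ray from $p_i$ in a first point other than its top-left corner. **Statement.** The layered strategy is an instance-optimal retrieval strategy: there is an absolute constant $c$ such that for all $n$, all $F^0$ as above and all $P\sim F^0$, every execution on $(F^0,P)$ terminates, and the set $A$ of regions it has retrieved satisfies: $F^0\odot_P A$ is finished and $|A|\le c\cdot r(F^0,P)$. Moreover, it retrieves only regions on the current outer Pareto front: in Stage 1 one always has $L_i(F)\subseteq \mathrm{OPF}(F)$ when layer $i$ is being processed, and in all three stages each region is, at the moment it is retrieved, on the outer Pareto front of the whole current family $F^0\odot_P A'$, where $A'$ is the set of regions retrieved before. -/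

import Mathlib

namespace ParetoRetrieval

/-- Points of the plane. -/
abbrev Pt : Type := ℝ × ℝ

/-- `p` dominates `q`: `p` lies in the open top-right quadrant of `q`. -/
def Dominates (p q : Pt) : Prop := q.1 < p.1 ∧ q.2 < p.2

/-- `p` dominates a region: the region lies in the open bottom-left quadrant of `p`. -/
def DominatesRegion (p : Pt) (R : Set Pt) : Prop := ∀ z ∈ R, Dominates p z

/-! ### Families of regions

A family of regions is a function `R : Fin n → Set Pt` together with the set `J` of the indices
that belong to it, so that subfamilies keep the names of their regions. -/

section Families

variable {n : ℕ}

/-- `P ∼ F`: each region of the family contains its point. -/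
def IsRealization (J : Set (Fin n)) (R : Fin n → Set Pt) (P : Fin n → Pt) : Prop :=
  ∀ i ∈ J, P i ∈ R i

/-- The (indices of the) points on the Pareto front of the points `P i`, `i ∈ J`. -/
def PF (J : Set (Fin n)) (P : Fin n → Pt) : Set (Fin n) :=
  {i | i ∈ J ∧ ∀ j ∈ J, ¬ Dominates (P j) (P i)}

/-- The order `a ≺ b` induced by traversing the Pareto front along its staircase: both points lie
on the front, and the first lies strictly to the left of or strictly above the second. -/
def FrontOrder (J : Set (Fin n)) (P : Fin n → Pt) (a b : Fin n) : Prop :=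
  a ∈ PF J P ∧ b ∈ PF J P ∧ ((P a).1 < (P b).1 ∨ (P b).2 < (P a).2)

/-- A family is finished if all its realizations induce the same order of the Pareto front. -/
def Finished (J : Set (Fin n)) (R : Fin n → Set Pt) : Prop :=
  ∀ P₁ P₂ : Fin n → Pt, IsRealization J R P₁ → IsRealization J R P₂ →
    ∀ a b : Fin n, FrontOrder J P₁ a b ↔ FrontOrder J P₂ a b

/-- The outer Pareto front: the regions with a point that no point of another region dominates. -/
def OPF (J : Set (Fin n)) (R : Fin n → Set Pt) : Set (Fin n) :=
  {a | a ∈ J ∧ ∃ p ∈ R a, ∀ b ∈ J, b ≠ a → ∀ q ∈ R b, ¬ Dominates q p}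

/-- The inner Pareto front: the area of the points that are dominated in every realization. -/
def IPF (J : Set (Fin n)) (R : Fin n → Set Pt) : Set Pt :=
  {z | ∀ P : Fin n → Pt, IsRealization J R P → ∃ i ∈ J, Dominates (P i) z}

/-- A region of the family is dominated if its point is on the Pareto front of no realization. -/
def IsDominated (J : Set (Fin n)) (R : Fin n → Set Pt) (a : Fin n) : Prop :=
  ∀ P : Fin n → Pt, IsRealization J R P → a ∉ PF J P

/-- The staircase of the outer Pareto front: the boundary of the area of the points that are not
dominated by a point of a region of the outer Pareto front. -/
def staircase (J : Set (Fin n)) (R : Fin n → Set Pt) : Set Pt :=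
  frontier {z | ∀ a ∈ OPF J R, ∀ q ∈ R a, ¬ Dominates q z}

end Families

/-! ### Rectangles -/

/-- A closed axis-aligned rectangle of positive width and height, given by its bottom-left and
top-right corners. -/
structure Rect where
  bl : Pt
  tr : Pt
  width_pos : bl.1 < tr.1
  height_pos : bl.2 < tr.2

namespace Rect

/-- The points of the closed rectangle. -/
def region (R : Rect) : Set Pt :=
  {z | R.bl.1 ≤ z.1 ∧ z.1 ≤ R.tr.1 ∧ R.bl.2 ≤ z.2 ∧ z.2 ≤ R.tr.2}

/-- The top-left corner. -/
def tl (R : Rect) : Pt := (R.bl.1, R.tr.2)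

/-- The bottom-right corner. -/
def br (R : Rect) : Pt := (R.tr.1, R.bl.2)

/-- The (closed) top facet. -/
def topFacet (R : Rect) : Set Pt := {z | z ∈ R.region ∧ z.2 = R.tr.2}

/-- The (closed) right facet. -/
def rightFacet (R : Rect) : Set Pt := {z | z ∈ R.region ∧ z.1 = R.tr.1}

end Rect

/-- `h` is the point at which the upward ray from `p` hits `R`, i.e. the first (lowest) point of
the closed ray that lies in `R`. -/
def UpwardHit (p : Pt) (R : Rect) (h : Pt) : Prop :=
  (h ∈ R.region ∧ h.1 = p.1 ∧ p.2 ≤ h.2) ∧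
    ∀ w ∈ R.region, w.1 = p.1 → p.2 ≤ w.2 → h.2 ≤ w.2

/-- `h` is the point at which the rightward ray from `p` hits `R`, i.e. the first (leftmost) point
of the closed ray that lies in `R`. -/
def RightwardHit (p : Pt) (R : Rect) (h : Pt) : Prop :=
  (h ∈ R.region ∧ h.2 = p.2 ∧ p.1 ≤ h.1) ∧
    ∀ w ∈ R.region, w.2 = p.2 → p.1 ≤ w.1 → h.1 ≤ w.1

section Strategy

variable {n : ℕ}

/-- The original family of regions of a family of rectangles. -/
def original (F : Fin n → Rect) : Fin n → Set Pt := fun i => (F i).region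

/-- The current family after retrieving the regions in `A`: these are replaced by their points. -/
def current (F : Fin n → Rect) (P : Fin n → Pt) (A : Finset (Fin n)) : Fin n → Set Pt :=
  fun i => if i ∈ A then {P i} else (F i).region

/-- The minimum number of retrievals after which the family is finished. The set is nonempty, since
retrieving all regions leaves only one realization. -/
noncomputable def minRetrievals (F : Fin n → Rect) (P : Fin n → Pt) : ℕ :=
  sInf {m | ∃ A : Finset (Fin n), A.card = m ∧ Finished Set.univ (current F P A)}

/-- `R_a` has an outgoing dependency to `R_b` in the original family. -/
def OutgoingDependency (F : Fin n → Rect) (a b : Fin n) : Prop :=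
  b ≠ a ∧ ∃ q ∈ (F b).region,
    ¬ DominatesRegion (F b).tr (F a).region ∧
    q ∉ IPF Set.univ (original F) ∧
    (q ∈ (F a).region ∨ Dominates (F a).tr q)

/-- The regions `I⁰` without any outgoing dependency. -/
def independent (F : Fin n → Rect) : Set (Fin n) :=
  {a | ∀ b, ¬ OutgoingDependency F a b}

/-- The regions of `F⁰ - I⁰`. -/
def dependent (F : Fin n → Rect) : Set (Fin n) := (independent F)ᶜ

/-- What remains of `F⁰ - I⁰` after removing the first `i` layers. -/
def remaining (F : Fin n → Rect) : ℕ → Set (Fin n)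
  | 0 => dependent F
  | i + 1 => remaining F i \ OPF (remaining F i) (original F)

/-- The layers of `F⁰ - I⁰`, numbered from `0`. -/
def layer (F : Fin n → Rect) (i : ℕ) : Set (Fin n) := OPF (remaining F i) (original F)

/-- The number `k` of (nonempty) layers. -/
noncomputable def numLayers (F : Fin n → Rect) : ℕ := sInf {i | layer F i = ∅}

/-- The active layer: the regions of the layer that are not dominated in the current family of the
dependent regions and have not been retrieved. -/
def activeLayer (F : Fin n → Rect) (P : Fin n → Pt) (A : Finset (Fin n)) (i : ℕ) :
    Set (Fin n) :=
  {a | a ∈ layer F i ∧ ¬ IsDominated (dependent F) (current F P A) a ∧ a ∉ A}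

/-- The test of Stage 2: the interior or the top or right facet of `R_a` intersects the staircase
of the outer Pareto front of the current dependent regions. -/
def CrossesStaircase (F : Fin n → Rect) (P : Fin n → Pt) (A : Finset (Fin n)) (a : Fin n) :
    Prop :=
  ((interior (F a).region ∪ (F a).topFacet ∪ (F a).rightFacet) ∩
    staircase (dependent F) (current F P A)).Nonempty

/-- The retrieved points on the outer Pareto front of the current dependent regions. -/
def vertices (F : Fin n → Rect) (P : Fin n → Pt) (A : Finset (Fin n)) : Set (Fin n) :=
  {v | v ∈ OPF (dependent F) (current F P A) ∧ v ∈ A}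

/-- The test of Stage 3: the upward ray from `p` hits the rectangle not in its bottom-right corner,
or the rightward ray from `p` hits it not in its top-left corner. -/
def RayHits (p : Pt) (R : Rect) : Prop :=
  (∃ h, UpwardHit p R h ∧ h ≠ R.br) ∨ (∃ h, RightwardHit p R h ∧ h ≠ R.tl)

/-- The control state of the strategy. -/
inductive Phase (n : ℕ) : Type
  /-- Stage 1 is processing layer `i`. -/
  | stage1 (i : ℕ) : Phase n
  /-- Stage 2 still has to consider the independent regions in `todo`. -/
  | stage2 (todo : Set (Fin n)) : Phase n
  /-- Stage 3 still has to consider the vertices in `todo`. -/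
  | stage3 (todo : Set (Fin n)) : Phase n
  /-- The strategy has terminated. -/
  | done : Phase n

/-- A configuration: the control state and the set of the regions retrieved so far. -/
structure Config (n : ℕ) : Type where
  phase : Phase n
  retrieved : Finset (Fin n)

/-- The steps of the layered strategy on `(F, P)`. Where the strategy says "any" or "for all", every
order is allowed. A step retrieves at most one region, and only regions that have not been
retrieved before. -/
inductive Step (F : Fin n → Rect) (P : Fin n → Pt) : Config n → Config n → Prop
  /-- Stage 1: retrieve any region of the active layer. -/
  | layerRetrieve (i : ℕ) (A : Finset (Fin n)) (a : Fin n) :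
      i < numLayers F → a ∈ activeLayer F P A i →
      Step F P ⟨.stage1 i, A⟩ ⟨.stage1 i, insert a A⟩
  /-- Stage 1: the active layer is empty, go to the next layer. -/
  | layerNext (i : ℕ) (A : Finset (Fin n)) :
      i < numLayers F → activeLayer F P A i = ∅ →
      Step F P ⟨.stage1 i, A⟩ ⟨.stage1 (i + 1), A⟩
  /-- Stage 1: all layers have been processed. -/
  | layerEnd (i : ℕ) (A : Finset (Fin n)) :
      numLayers F ≤ i →
      Step F P ⟨.stage1 i, A⟩ ⟨.stage2 (independent F), A⟩
  /-- Stage 2: an independent region passes the test and is retrieved. -/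
  | crossRetrieve (T : Set (Fin n)) (A : Finset (Fin n)) (a : Fin n) :
      a ∈ T → CrossesStaircase F P A a →
      Step F P ⟨.stage2 T, A⟩ ⟨.stage2 (T \ {a}), insert a A⟩
  /-- Stage 2: an independent region fails the test. -/
  | crossSkip (T : Set (Fin n)) (A : Finset (Fin n)) (a : Fin n) :
      a ∈ T → ¬ CrossesStaircase F P A a →
      Step F P ⟨.stage2 T, A⟩ ⟨.stage2 (T \ {a}), A⟩
  /-- Stage 2: all independent regions have been considered. -/
  | crossEnd (A : Finset (Fin n)) :
      Step F P ⟨.stage2 ∅, A⟩ ⟨.stage3 (vertices F P A), A⟩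
  /-- Stage 3: retrieve an independent region that is hit by a ray from a vertex. -/
  | rayRetrieve (V : Set (Fin n)) (A : Finset (Fin n)) (v a : Fin n) :
      v ∈ V → a ∈ independent F → a ∉ A → RayHits (P v) (F a) →
      Step F P ⟨.stage3 V, A⟩ ⟨.stage3 V, insert a A⟩
  /-- Stage 3: all independent regions hit by a ray from the vertex have been retrieved. -/
  | rayNext (V : Set (Fin n)) (A : Finset (Fin n)) (v : Fin n) :
      v ∈ V → (∀ a ∈ independent F, RayHits (P v) (F a) → a ∈ A) →
      Step F P ⟨.stage3 V, A⟩ ⟨.stage3 (V \ {v}), A⟩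
  /-- Stage 3: all vertices have been considered. -/
  | rayEnd (A : Finset (Fin n)) :
      Step F P ⟨.stage3 ∅, A⟩ ⟨.done, A⟩

/-- The strategy starts with the first layer and without retrieved regions. -/
def start : Config n := ⟨.stage1 0, ∅⟩

/-- The configurations that some execution of the strategy on `(F, P)` reaches. -/
def Reachable (F : Fin n → Rect) (P : Fin n → Pt) (C : Config n) : Prop :=
  Relation.ReflTransGen (Step F P) start C

end Strategy

end ParetoRetrieval

open ParetoRetrieval

namespace ParetoRetrieval

/-! Every current region is a box, degenerate once it is retrieved, so outer front, inner front and
domination reduce to comparisons between bottom-left and top-right corners. The pivot is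
`mem_dependent_of_dominates`: only dependent regions can have points that dominate the top-right
corner of another region.

Correctness: after Stage 1 each dependent region is retrieved or has its top-right corner dominated
by a retrieved dependent point. Hence the outer front of the dependent regions is already the true
front `Vtx` of their points, and the later stages test against a fixed staircase
(`OPF_dependent_eq`). At the end, an unretrieved region either has a top-right corner dominated by a
retrieved point, so it never matters, or it is `Free`. A free region is on the front of every
realization (`mem_PF_of_free`) and disjoint from the current regions of all other front points
(`disjoint_of_free`); two disjoint boxes whose points stay on the front keep their order
(`frontOrder_of_disjoint`). That retrieved regions lie on the outer front uses the same fact: no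
current region reaches beyond their top-right corners.

Optimality: let `B` be any set whose retrieval finishes the family. No point of the realization
dominates the top-right corner of a region retrieved by the strategy, so such a region outside `B`
is `Alive` for `B`. Finishedness forces the alive regions into a chain descending from upper left to
lower right (`upperLeft_or`). Along such a chain, a point can be charged at most once in each of six
ways (`not_charge_of_upperLeft`). Dependent regions are charged to the top-right corners and the
points of the regions in `B`, independent ones to vertices, which are retrieved dependent regions
themselves. -/

/-- The closed axis-aligned box with bottom-left corner `l` and top-right corner `h`. -/
def box (l h : Pt) : Set Pt := {z | l.1 ≤ z.1 ∧ z.1 ≤ h.1 ∧ l.2 ≤ z.2 ∧ z.2 ≤ h.2}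

theorem Dominates.trans {p q r : Pt} (h₁ : Dominates p q) (h₂ : Dominates q r) : Dominates p r :=
  ⟨h₂.1.trans h₁.1, h₂.2.trans h₁.2⟩

theorem Dominates.irrefl (p : Pt) : ¬ Dominates p p := fun h => lt_irrefl _ h.1

/-- In a finite family, each point is on the front or dominated by a point of the front. -/
theorem exists_maximal {n : ℕ} (J : Set (Fin n)) (Q : Fin n → Pt) {j : Fin n} (hj : j ∈ J) :
    ∃ k ∈ PF J Q, k = j ∨ Dominates (Q k) (Q j) := by
  classical
  let s : Finset (Fin n) := {k | k ∈ J ∧ (k = j ∨ Dominates (Q k) (Q j))}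
  have hs : s.Nonempty := ⟨j, by simp [s, hj]⟩
  obtain ⟨k, hk, hmax⟩ := Finset.exists_max_image s (fun k => (Q k).1) hs
  simp only [s, Finset.mem_filter, Finset.mem_univ, true_and] at hk hmax
  refine ⟨k, ⟨hk.1, fun l hl hd => ?_⟩, hk.2⟩
  have hlj : Dominates (Q l) (Q j) := by
    rcases hk.2 with rfl | h
    · exact hd
    · exact hd.trans h
  exact absurd (hmax l ⟨hl, Or.inr hlj⟩) (not_le.2 hd.1)

/-! ### Outer front, inner front, domination and staircase for families of boxes -/

section Boxes

variable {n : ℕ} {J : Set (Fin n)} {lo hi : Fin n → Pt}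

theorem mem_OPF_box (hle : ∀ i, lo i ≤ hi i) {a : Fin n} :
    a ∈ OPF J (fun i => box (lo i) (hi i)) ↔ a ∈ J ∧ ∀ b ∈ J, ¬ Dominates (hi b) (hi a) := by
  constructor
  · rintro ⟨ha, p, hp, h⟩
    refine ⟨ha, fun b hb hd => ?_⟩
    have hba : b ≠ a := by rintro rfl; exact Dominates.irrefl _ hd
    refine h b hb hba (hi b) ⟨(hle b).1, le_rfl, (hle b).2, le_rfl⟩ ⟨?_, ?_⟩
    · exact lt_of_le_of_lt hp.2.1 hd.1
    · exact lt_of_le_of_lt hp.2.2.2 hd.2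
  · rintro ⟨ha, h⟩
    refine ⟨ha, hi a, ⟨(hle a).1, le_rfl, (hle a).2, le_rfl⟩, fun b hb _ q hq hd => h b hb ⟨?_, ?_⟩⟩
    · exact lt_of_lt_of_le hd.1 hq.2.1
    · exact lt_of_lt_of_le hd.2 hq.2.2.2

theorem mem_IPF_box (hle : ∀ i, lo i ≤ hi i) {z : Pt} :
    z ∈ IPF J (fun i => box (lo i) (hi i)) ↔ ∃ k ∈ J, Dominates (lo k) z := by
  constructor
  · intro h
    exact h lo fun i _ => ⟨le_rfl, (hle i).1, le_rfl, (hle i).2⟩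
  · rintro ⟨k, hk, hd⟩ Q hQ
    exact ⟨k, hk, lt_of_lt_of_le hd.1 (hQ k hk).1, lt_of_lt_of_le hd.2 (hQ k hk).2.2.1⟩

/-- The realization most favourable to `a` puts `a` at its upper corner and all other points at
their lower corners. -/
theorem isDominated_box (hle : ∀ i, lo i ≤ hi i) {a : Fin n} (ha : a ∈ J) :
    IsDominated J (fun i => box (lo i) (hi i)) a ↔ ∃ k ∈ J, Dominates (lo k) (hi a) := by
  classical
  constructor
  · intro h
    have hR : IsRealization J (fun i => box (lo i) (hi i)) (Function.update lo a (hi a)) := by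
      intro i _
      rcases eq_or_ne i a with rfl | hi'
      · simpa using ⟨(hle i).1, le_rfl, (hle i).2, le_rfl⟩
      · simpa [hi'] using ⟨le_rfl, (hle i).1, le_rfl, (hle i).2⟩
    have := h _ hR
    simp only [PF, Set.mem_ofPred_eq, ha, true_and, not_forall, not_not] at this
    obtain ⟨k, hk, hd⟩ := this
    rw [Function.update_self] at hd
    rcases eq_or_ne k a with rfl | hka
    · rw [Function.update_self] at hd
      exact absurd hd (Dominates.irrefl _)
    · rw [Function.update_of_ne hka] at hd
      exact ⟨k, hk, hd⟩
  · rintro ⟨k, hk, hd⟩ Q hQ hPF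
    refine hPF.2 k hk ⟨?_, ?_⟩
    · linarith [(hQ k hk).1, (hQ a ha).2.1, hd.1]
    · linarith [(hQ k hk).2.2.1, (hQ a ha).2.2.2, hd.2]

/-- The frontier of the set of the points that no point `p v`, `v ∈ V`, dominates. -/
theorem mem_frontier_undominated (V : Set (Fin n)) (p : Fin n → Pt) {z : Pt} :
    z ∈ frontier {z | ∀ v ∈ V, ¬ Dominates (p v) z} ↔
      (∀ v ∈ V, ¬ Dominates (p v) z) ∧ ∃ v ∈ V, z ≤ p v := by
  have hV : V.Finite := Set.toFinite V
  have hopen : ∀ v, IsOpen {z : Pt | Dominates (p v) z} := fun v =>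
    (isOpen_lt continuous_fst continuous_const).inter (isOpen_lt continuous_snd continuous_const)
  have hcl : IsClosed {z : Pt | ∀ v ∈ V, ¬ Dominates (p v) z} := by
    have : {z : Pt | ∀ v ∈ V, ¬ Dominates (p v) z} = ⋂ v ∈ V, {z : Pt | Dominates (p v) z}ᶜ := by
      ext; simp
    rw [this]
    exact isClosed_biInter fun v _ => (hopen v).isClosed_compl
  rw [hcl.frontier_eq]
  constructor
  · rintro ⟨hz, hint⟩
    refine ⟨hz, ?_⟩
    by_contra! hcon
    apply hint
    -- If `z` is below no `p v` even weakly, this persists in a neighbourhood, and nothing there is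
    -- dominated.
    have hop : IsOpen (⋂ v ∈ V, {z : Pt | z ≤ p v}ᶜ) :=
      hV.isOpen_biInter fun v _ => (isClosed_le continuous_id continuous_const).isOpen_compl
    refine interior_maximal (fun w hw v hv hd => ?_) hop ?_
    · simp only [Set.mem_iInter] at hw
      exact hw v hv ⟨hd.1.le, hd.2.le⟩
    · simp only [Set.mem_iInter]
      exact fun v hv => hcon v hv
  · rintro ⟨hz, v, hv, hle⟩
    refine ⟨hz, fun hint => ?_⟩
    -- Moving from `z ≤ p v` diagonally down and left gives points arbitrarily close to `z` that `p
    -- v` dominates.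
    have hc : Filter.Tendsto (fun t : ℝ => ((z.1 - t, z.2 - t) : Pt)) (nhdsWithin 0 (Set.Ioi 0))
        (nhds z) := by
      have : Continuous (fun t : ℝ => ((z.1 - t, z.2 - t) : Pt)) := by fun_prop
      have h0 := (this.tendsto 0).mono_left (nhdsWithin_le_nhds (s := Set.Ioi 0))
      simpa using h0
    have hev := hc.eventually (mem_interior_iff_mem_nhds.1 hint)
    obtain ⟨t, ht, ht0⟩ := (hev.and self_mem_nhdsWithin).exists
    have ht0' : (0 : ℝ) < t := ht0
    refine ht v hv ⟨?_, ?_⟩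
    · show z.1 - t < (p v).1
      linarith [hle.1]
    · show z.2 - t < (p v).2
      linarith [hle.2]

theorem mem_staircase_box (hle : ∀ i, lo i ≤ hi i) {z : Pt} :
    z ∈ staircase J (fun i => box (lo i) (hi i)) ↔
      (∀ v ∈ OPF J (fun i => box (lo i) (hi i)), ¬ Dominates (hi v) z) ∧
        ∃ v ∈ OPF J (fun i => box (lo i) (hi i)), z ≤ hi v := by
  rw [← mem_frontier_undominated, staircase]
  suffices h : {z | ∀ a ∈ OPF J (fun i => box (lo i) (hi i)), ∀ q ∈ box (lo a) (hi a),
      ¬ Dominates q z} = {z | ∀ v ∈ OPF J (fun i => box (lo i) (hi i)), ¬ Dominates (hi v) z} by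
    rw [h]
  refine Set.ext fun w => forall₂_congr fun v _ => ⟨fun h => h (hi v) ⟨(hle v).1, le_rfl, (hle v).2, le_rfl⟩, ?_⟩
  intro h q hq hd
  exact h ⟨lt_of_lt_of_le hd.1 hq.2.1, lt_of_lt_of_le hd.2 hq.2.2.2⟩

/-! ### Finished families of boxes -/

/-- Some front point `k` is at or beyond `Q j`, hence elsewhere than `Q a`. So `a` and `k` are
comparable in the front order, and finishedness carries this comparison, with the membership of `a`
in the front, to `Q'`. -/
theorem PF_of_finished {R : Fin n → Set Pt} (hfin : Finished Set.univ R) {Q Q' : Fin n → Pt}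
    (hQ : IsRealization Set.univ R Q) (hQ' : IsRealization Set.univ R Q') {a j : Fin n}
    (ha : a ∈ PF Set.univ Q) (hne : Q j ≠ Q a) (hnd : ¬ Dominates (Q a) (Q j)) :
    a ∈ PF Set.univ Q' := by
  obtain ⟨k, hk, hkj⟩ := exists_maximal Set.univ Q (Set.mem_univ j)
  have hka : Q k ≠ Q a := by
    rcases hkj with rfl | h
    · exact hne
    · intro e
      exact hnd (e ▸ h)
  have hord : FrontOrder Set.univ Q a k ∨ FrontOrder Set.univ Q k a := by
    by_contra! hcon
    obtain ⟨h1, h2⟩ := hcon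
    simp only [FrontOrder, ha, hk, true_and, not_or, not_lt] at h1 h2
    exact hka (Prod.ext (le_antisymm h1.1 h2.1) (le_antisymm h2.2 h1.2))
  rcases hord with h | h
  · exact ((hfin Q Q' hQ hQ' _ _).1 h).1
  · exact ((hfin Q Q' hQ hQ' _ _).1 h).2.1

theorem isRealization_update₂ (hle : ∀ i, lo i ≤ hi i) {a j : Fin n} {p q : Pt}
    (hp : p ∈ box (lo a) (hi a)) (hq : q ∈ box (lo j) (hi j)) :
    IsRealization Set.univ (fun i => box (lo i) (hi i))
      (Function.update (Function.update lo j q) a p) := by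
  intro i _
  rcases eq_or_ne i a with rfl | hia
  · simpa using hp
  · rcases eq_or_ne i j with rfl | hij
    · simpa [hia] using hq
    · simpa [hia, hij] using ⟨le_rfl, (hle i).1, le_rfl, (hle i).2⟩

/-- In a finished family, no point can dominate a point of a region that is not dominated. -/
theorem not_dominates_of_finished (hle : ∀ i, lo i ≤ hi i)
    (hfin : Finished Set.univ (fun i => box (lo i) (hi i))) {a j : Fin n} (hja : j ≠ a)
    (ha : ∀ k, ¬ Dominates (lo k) (hi a)) : ¬ Dominates (hi j) (lo a) := by
  intro hd
  have hhi : ∀ i, hi i ∈ box (lo i) (hi i) := fun i => ⟨(hle i).1, le_rfl, (hle i).2, le_rfl⟩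
  have hlo : ∀ i, lo i ∈ box (lo i) (hi i) := fun i => ⟨le_rfl, (hle i).1, le_rfl, (hle i).2⟩
  -- A realization with `a` on the front in which all other points are at `p` or dominated by it.
  have key : ∀ p ∈ box (lo a) (hi a), ∀ q ∈ box (lo j) (hi j), ¬ Dominates q p →
      (∀ k, ¬ Dominates (lo k) p) →
      (q = p ∨ Dominates p q) ∧ ∀ k, k ≠ a → k ≠ j → (lo k = p ∨ Dominates p (lo k)) := by
    intro p hp q hq hqp hkp
    set Q := Function.update (Function.update lo j q) a p with hQdef
    have hQa : Q a = p := by simp [hQdef]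
    have hQj : Q j = q := by simp [hQdef, hja]
    have hQk : ∀ k, k ≠ a → k ≠ j → Q k = lo k := fun k h1 h2 => by simp [hQdef, h1, h2]
    have hQ : IsRealization Set.univ (fun i => box (lo i) (hi i)) Q :=
      isRealization_update₂ hle hp hq
    have haPF : a ∈ PF Set.univ Q := by
      refine ⟨trivial, fun k _ => ?_⟩
      rw [hQa]
      rcases eq_or_ne k a with rfl | hka
      · rw [hQa]; exact Dominates.irrefl _
      · rcases eq_or_ne k j with rfl | hkj
        · rwa [hQj]
        · rw [hQk k hka hkj]; exact hkp k
    -- Here `a` sits at its lower corner and `j` at its upper one, so `a` is off the front;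
    -- `PF_of_finished` then rules out any other point that is neither at `p` nor dominated by it.
    have hQ' := isRealization_update₂ hle (hlo a) (hhi j)
    have hnot : ∀ k, Q k = Q a ∨ Dominates (Q a) (Q k) := by
      intro k
      by_contra! hcon
      have := (PF_of_finished hfin hQ hQ' haPF hcon.1 hcon.2).2 j trivial
      simp only [Function.update_self, Function.update_of_ne hja] at this
      exact this hd
    constructor
    · simpa [hQa, hQj] using hnot j
    · intro k h1 h2
      simpa [hQa, hQk k h1 h2] using hnot k
  have h1a := (hle a).1
  have h2a := (hle a).2
  have h1j := (hle j).1
  have h2j := (hle j).2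
  -- If `hi j` is beyond `hi a`, lowering `j` to `lo j` in one suitable coordinate stops the
  -- domination, while the other coordinate stays above that of `hi a`, contradicting `key`.
  by_cases hja' : Dominates (hi j) (hi a)
  · have hl := ha j
    simp only [Dominates, not_and_or, not_lt] at hl
    obtain ⟨e1, e2⟩ := hja'
    rcases hl with hl | hl
    · rcases (key (hi a) (hhi a) ((lo j).1, (hi j).2) ⟨le_rfl, h1j, h2j, le_rfl⟩
        (fun h => not_lt.2 hl h.1) ha).1 with h | h
      · rw [Prod.ext_iff] at h
        exact e2.ne' h.2
      · exact lt_asymm e2 h.2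
    · rcases (key (hi a) (hhi a) ((hi j).1, (lo j).2) ⟨h1j, le_rfl, le_rfl, h2j⟩
        (fun h => not_lt.2 hl h.2) ha).1 with h | h
      · rw [Prod.ext_iff] at h
        exact e1.ne' h.1
      · exact lt_asymm e1 h.1
  · obtain ⟨hj, hk⟩ := key (hi a) (hhi a) (hi j) (hhi j) hja' ha
    have hjle : (hi j).1 ≤ (hi a).1 := by
      rcases hj with h | h
      · rw [h]
      · exact h.1.le
    -- Otherwise `a` moves to its bottom-right corner: `hi j` is not right of it, so does not
    -- dominate it, but is strictly above it.
    have hbr := (key ((hi a).1, (lo a).2) ⟨h1a, le_rfl, le_rfl, h2a⟩ (hi j) (hhi j)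
      (fun h => not_lt.2 hjle h.1) ?_).1
    · rcases hbr with h | h
      · rw [Prod.ext_iff] at h
        exact hd.2.ne' h.2
      · exact lt_asymm hd.2 h.2
    · rintro k ⟨d1, d2⟩
      simp only at d1 d2
      rcases eq_or_ne k a with rfl | hka
      · exact lt_irrefl _ d2
      · rcases eq_or_ne k j with rfl | hkj
        · linarith
        · rcases hk k hka hkj with h | h
          · rw [h] at d1
            exact lt_irrefl _ d1
          · exact lt_asymm d1 h.1

/-- In a finished family, two regions that are not dominated are disjoint, unless both of them are
points. -/
theorem disjoint_of_finished (hle : ∀ i, lo i ≤ hi i)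
    (hfin : Finished Set.univ (fun i => box (lo i) (hi i))) {a b : Fin n} (hab : b ≠ a)
    (ha : ∀ k, ¬ Dominates (lo k) (hi a)) (hb : ∀ k, ¬ Dominates (lo k) (hi b))
    (hfat : lo a ≠ hi a) {z : Pt} (hza : z ∈ box (lo a) (hi a)) : z ∉ box (lo b) (hi b) := by
  intro hzb
  obtain ⟨p, hp, hpz⟩ : ∃ p ∈ box (lo a) (hi a), p ≠ z := by
    by_cases h : lo a = z
    · exact ⟨hi a, ⟨(hle a).1, le_rfl, (hle a).2, le_rfl⟩, fun e => hfat (h.trans e.symm)⟩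
    · exact ⟨lo a, ⟨le_rfl, (hle a).1, le_rfl, (hle a).2⟩, h⟩
  have hPF : ∀ c, (∀ k, ¬ Dominates (lo k) (hi c)) → ∀ Q,
      IsRealization Set.univ (fun i => box (lo i) (hi i)) Q → c ∈ PF Set.univ Q := by
    refine fun c hc Q hQ => ⟨trivial, fun k _ hd => ?_⟩
    rcases eq_or_ne k c with rfl | hkc
    · exact Dominates.irrefl _ hd
    · refine not_dominates_of_finished hle hfin hkc hc ⟨?_, ?_⟩
      · linarith [(hQ c trivial).1, (hQ k trivial).2.1, hd.1]
      · linarith [(hQ c trivial).2.2.1, (hQ k trivial).2.2.2, hd.2]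
  -- With `b` at `z`, the front points `a` and `b` are unordered when `a` is also at `z`, but
  -- ordered when `a` is at `p ≠ z`.
  have hQ := isRealization_update₂ hle hp hzb
  have hQ' := isRealization_update₂ hle hza hzb
  set Q := Function.update (Function.update lo b z) a p with hQdef
  set Q' := Function.update (Function.update lo b z) a z with hQdef'
  have e1 : Q a = p := by simp [hQdef]
  have e2 : Q b = z := by simp [hQdef, hab]
  have e3 : Q' a = z := by simp [hQdef']
  have e4 : Q' b = z := by simp [hQdef', hab]
  have h1 := hfin Q Q' hQ hQ' a b
  have h2 := hfin Q Q' hQ hQ' b a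
  simp only [FrontOrder, hPF a ha Q hQ, hPF a ha Q' hQ', hPF b hb Q hQ, hPF b hb Q' hQ', e1, e2,
    e3, e4, true_and, lt_irrefl, or_self, iff_false, not_or, not_lt] at h1 h2
  exact hpz (Prod.ext (le_antisymm h2.1 h1.1) (le_antisymm h1.2 h2.2))

end Boxes

/-! ### Current families as boxes, and dependencies in terms of corners -/

section Strategy

variable {n : ℕ} {F : Fin n → Rect} {P : Fin n → Pt} {A : Finset (Fin n)}

/-- The bottom-left corner of the current region. -/
def lower (F : Fin n → Rect) (P : Fin n → Pt) (A : Finset (Fin n)) (i : Fin n) : Pt :=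
  if i ∈ A then P i else (F i).bl

/-- The top-right corner of the current region. -/
def upper (F : Fin n → Rect) (P : Fin n → Pt) (A : Finset (Fin n)) (i : Fin n) : Pt :=
  if i ∈ A then P i else (F i).tr

theorem bl_le_tr (R : Rect) : R.bl ≤ R.tr := ⟨R.width_pos.le, R.height_pos.le⟩

theorem lower_le_upper (i : Fin n) : lower F P A i ≤ upper F P A i := by
  unfold lower upper
  split_ifs
  · exact le_rfl
  · exact bl_le_tr _

theorem current_eq_box : current F P A = fun i => box (lower F P A i) (upper F P A i) := by
  funext i
  unfold current lower upper
  split_ifs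
  · ext z
    constructor
    · rintro rfl
      exact ⟨le_rfl, le_rfl, le_rfl, le_rfl⟩
    · rintro ⟨h1, h2, h3, h4⟩
      exact Prod.ext (le_antisymm h2 h1) (le_antisymm h4 h3)
  · rfl

theorem original_eq_box : original F = fun i => box (F i).bl (F i).tr := rfl

theorem mem_IPF_original {z : Pt} :
    z ∈ IPF Set.univ (original F) ↔ ∃ k, Dominates (F k).bl z := by
  rw [original_eq_box, mem_IPF_box fun i => bl_le_tr (F i)]
  simp

theorem tr_mem (R : Rect) : R.tr ∈ R.region :=
  ⟨R.width_pos.le, le_rfl, R.height_pos.le, le_rfl⟩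

theorem dominatesRegion_iff {p : Pt} {R : Rect} : DominatesRegion p R.region ↔ Dominates p R.tr :=
  ⟨fun h => h _ (tr_mem R),
    fun h _ hz => ⟨lt_of_le_of_lt hz.2.1 h.1, lt_of_le_of_lt hz.2.2.2 h.2⟩⟩

/-- A bottom-left corner dominating the top-right corner would put the whole region into the inner
front. -/
theorem tr_not_dominated (hF : ∀ i, ¬ (F i).region ⊆ IPF Set.univ (original F)) (i k : Fin n) :
    ¬ Dominates (F k).bl (F i).tr := fun h => hF i fun _ hz =>
  mem_IPF_original.2 ⟨k, lt_of_le_of_lt hz.2.1 h.1, lt_of_le_of_lt hz.2.2.2 h.2⟩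

theorem mem_dependent_of {a b : Fin n} (hba : b ≠ a) {q : Pt} (hq : q ∈ (F b).region)
    (hdom : ¬ Dominates (F b).tr (F a).tr) (hI : ∀ k, ¬ Dominates (F k).bl q)
    (h : q ∈ (F a).region ∨ Dominates (F a).tr q) : a ∈ dependent F := fun ha =>
  ha b ⟨hba, q, hq, by rwa [dominatesRegion_iff],
    fun hm => (mem_IPF_original.1 hm).elim hI, h⟩

theorem exists_of_mem_dependent {a : Fin n} (ha : a ∈ dependent F) :
    ∃ b, b ≠ a ∧ ∃ q ∈ (F b).region, ¬ Dominates (F b).tr (F a).tr ∧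
      (∀ k, ¬ Dominates (F k).bl q) ∧ (q ∈ (F a).region ∨ Dominates (F a).tr q) := by
  simp only [dependent, independent, Set.mem_compl_iff, Set.mem_ofPred_eq, not_forall,
    not_not] at ha
  obtain ⟨b, hba, q, hq, h1, h2, h3⟩ := ha
  rw [dominatesRegion_iff] at h1
  exact ⟨b, hba, q, hq, h1, fun k hk => h2 (mem_IPF_original.2 ⟨k, hk⟩), h3⟩

/-- A region whose top-right corner dominates another region depends on it. -/
theorem mem_dependent_of_dominates (hF : ∀ i, ¬ (F i).region ⊆ IPF Set.univ (original F))
    {a b : Fin n} (h : Dominates (F b).tr (F a).tr) : b ∈ dependent F := by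
  refine mem_dependent_of (b := a) ?_ (tr_mem _) (fun h' => ?_) (tr_not_dominated hF a) (Or.inr h)
  · rintro rfl
    exact Dominates.irrefl _ h
  · exact Dominates.irrefl _ (h.trans h')

theorem le_tr_of_realization (hP : IsRealization Set.univ (original F) P) (i : Fin n) :
    P i ≤ (F i).tr := ⟨(hP i trivial).2.1, (hP i trivial).2.2.2⟩

theorem bl_le_of_realization (hP : IsRealization Set.univ (original F) P) (i : Fin n) :
    (F i).bl ≤ P i := ⟨(hP i trivial).1, (hP i trivial).2.2.1⟩

theorem Dominates.of_le {p p' q q' : Pt} (h : Dominates p q) (hp : p ≤ p') (hq : q' ≤ q) :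
    Dominates p' q' :=
  ⟨lt_of_le_of_lt hq.1 (lt_of_lt_of_le h.1 hp.1), lt_of_le_of_lt hq.2 (lt_of_lt_of_le h.2 hp.2)⟩

theorem upper_le_tr (hP : IsRealization Set.univ (original F) P) (i : Fin n) :
    upper F P A i ≤ (F i).tr := by
  unfold upper
  split_ifs
  · exact le_tr_of_realization hP i
  · exact le_rfl

theorem le_upper (hP : IsRealization Set.univ (original F) P) (i : Fin n) :
    P i ≤ upper F P A i := by
  unfold upper
  split_ifs
  · exact le_rfl
  · exact le_tr_of_realization hP i

theorem mem_OPF_current {J : Set (Fin n)} {a : Fin n} :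
    a ∈ OPF J (current F P A) ↔ a ∈ J ∧ ∀ b ∈ J, ¬ Dominates (upper F P A b) (upper F P A a) := by
  rw [current_eq_box, mem_OPF_box lower_le_upper]

theorem mem_OPF_original {J : Set (Fin n)} {a : Fin n} :
    a ∈ OPF J (original F) ↔ a ∈ J ∧ ∀ b ∈ J, ¬ Dominates (F b).tr (F a).tr := by
  rw [original_eq_box, mem_OPF_box fun i => bl_le_tr (F i)]

/-- On unretrieved regions, domination is domination by a retrieved point. -/
theorem isDominated_current_iff (hF : ∀ i, ¬ (F i).region ⊆ IPF Set.univ (original F))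
    {J : Set (Fin n)} {a : Fin n} (ha : a ∈ J) (haA : a ∉ A) :
    IsDominated J (current F P A) a ↔ ∃ k ∈ J, k ∈ A ∧ Dominates (P k) (F a).tr := by
  rw [current_eq_box, isDominated_box lower_le_upper ha]
  simp only [upper, if_neg haA]
  refine exists_congr fun k => and_congr_right fun _ => ?_
  unfold lower
  split_ifs with hk
  · simp [hk]
  · simpa [hk] using tr_not_dominated hF a k

/-! ### Layers -/

theorem remaining_subset_dependent : ∀ i, remaining F i ⊆ dependent F
  | 0 => subset_rfl
  | i + 1 => Set.sdiff_subset.trans (remaining_subset_dependent i)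

theorem exists_layer_of_notMem_remaining {a : Fin n} (ha : a ∈ dependent F) :
    ∀ i, a ∉ remaining F i → ∃ j < i, a ∈ layer F j
  | 0, h => absurd ha h
  | i + 1, h => by
    by_cases hi : a ∈ remaining F i
    · refine ⟨i, i.lt_succ_self, ?_⟩
      by_contra hl
      exact h ⟨hi, hl⟩
    · obtain ⟨j, hj, hl⟩ := exists_layer_of_notMem_remaining ha i hi
      exact ⟨j, hj.trans i.lt_succ_self, hl⟩

theorem layer_eq_empty_iff {i : ℕ} : layer F i = ∅ ↔ remaining F i = ∅ := by
  constructor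
  · intro h
    by_contra hne
    obtain ⟨j, hj⟩ := Set.nonempty_iff_ne_empty.2 hne
    obtain ⟨k, hk, -⟩ := exists_maximal (remaining F i) (fun i => (F i).tr) hj
    have : k ∈ layer F i := mem_OPF_original.2 hk
    rw [h] at this
    exact this
  · intro h
    rw [layer, h]
    exact Set.eq_empty_of_forall_notMem fun a ha => ha.1

theorem remaining_numLayers (F : Fin n → Rect) : remaining F (numLayers F) = ∅ := by
  rw [← layer_eq_empty_iff]
  -- An infimum over the empty set would be 0, so an empty layer must be exhibited: otherwise the
  -- cardinalities of `remaining F i` would decrease forever.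
  refine Nat.sInf_mem (s := {i | layer F i = ∅}) ?_
  by_contra hcon
  rw [Set.not_nonempty_iff_eq_empty] at hcon
  have hne : ∀ i, (layer F i).Nonempty := fun i => by
    rw [Set.nonempty_iff_ne_empty]
    intro h
    have : i ∈ {i | layer F i = ∅} := h
    rw [hcon] at this
    exact this
  have hlt : ∀ i, (remaining F (i + 1)).ncard < (remaining F i).ncard := fun i => by
    obtain ⟨a, ha⟩ := hne i
    refine Set.ncard_lt_ncard ⟨Set.sdiff_subset, fun h => ?_⟩
    exact (h ha.1).2 ha
  exact not_strictAnti_of_wellFoundedLT _ 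
    (strictAnti_nat_of_succ_lt (f := fun i => (remaining F i).ncard) hlt)

theorem exists_layer {a : Fin n} (ha : a ∈ dependent F) : ∃ j < numLayers F, a ∈ layer F j :=
  exists_layer_of_notMem_remaining ha _ (by rw [remaining_numLayers]; exact id)

/-- Regions that dominate the top-right corner of a region of a layer are in an earlier layer. -/
theorem exists_earlier_layer {a b : Fin n} {i : ℕ} (ha : a ∈ layer F i) (hb : b ∈ dependent F)
    (h : Dominates (F b).tr (F a).tr) : ∃ j < i, b ∈ layer F j :=
  exists_layer_of_notMem_remaining hb i fun hm => (mem_OPF_original.1 ha).2 b hm h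

/-! ### The result of Stage 1 -/

/-- Each region of `J` is retrieved or dominated by a retrieved point of a dependent region. -/
def Resolved (F : Fin n → Rect) (P : Fin n → Pt) (A : Finset (Fin n)) (J : Set (Fin n)) : Prop :=
  ∀ a ∈ J, a ∈ A ∨ ∃ k ∈ dependent F, k ∈ A ∧ Dominates (P k) (F a).tr

theorem Resolved.insert {J : Set (Fin n)} (h : Resolved F P A J) (b : Fin n) :
    Resolved F P (insert b A) J := fun a ha => (h a ha).imp (Finset.mem_insert_of_mem ·)
  fun ⟨k, hk, hkA, hd⟩ => ⟨k, hk, Finset.mem_insert_of_mem hkA, hd⟩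

theorem resolved_layer_of_activeLayer_eq_empty
    (hF : ∀ i, ¬ (F i).region ⊆ IPF Set.univ (original F)) {i : ℕ}
    (h : activeLayer F P A i = ∅) : Resolved F P A (layer F i) := by
  intro a ha
  by_cases haA : a ∈ A
  · exact Or.inl haA
  · right
    have hdep := remaining_subset_dependent i ha.1
    rw [← isDominated_current_iff hF hdep haA]
    by_contra hcon
    have : a ∈ activeLayer F P A i := ⟨ha, hcon, haA⟩
    rw [h] at this
    exact this

/-- The dependent points that are on the front of all dependent points. -/
def Vtx (F : Fin n → Rect) (P : Fin n → Pt) : Set (Fin n) := PF (dependent F) P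

theorem Vtx_subset (hP : IsRealization Set.univ (original F) P)
    (h : Resolved F P A (dependent F)) {v : Fin n} (hv : v ∈ Vtx F P) : v ∈ A := by
  rcases h v hv.1 with h | ⟨k, hk, -, hd⟩
  · exact h
  · exact absurd (hd.of_le le_rfl (le_tr_of_realization hP v)) (hv.2 k hk)

theorem exists_Vtx_of_dominates {k : Fin n} (hk : k ∈ dependent F) {z : Pt}
    (h : Dominates (P k) z) : ∃ v ∈ Vtx F P, Dominates (P v) z := by
  obtain ⟨v, hv, rfl | hd⟩ := exists_maximal (dependent F) P hk
  · exact ⟨v, hv, h⟩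
  · exact ⟨v, hv, hd.trans h⟩

/-- An unretrieved dependent region has a dominated top-right corner, so it neither lies on the
outer front nor hides a front point. The right side does not mention `A`, which makes the tests of
Stages 2 and 3 independent of the order of retrieval. -/
theorem OPF_dependent_eq (hP : IsRealization Set.univ (original F) P)
    (h : Resolved F P A (dependent F)) : OPF (dependent F) (current F P A) = Vtx F P := by
  ext v
  rw [mem_OPF_current]
  constructor
  · rintro ⟨hv, hmax⟩
    have hvA : v ∈ A := by
      by_contra hvA
      rcases h v hv with h | ⟨k, hk, hkA, hd⟩
      · exact hvA h
      · refine hmax k hk ?_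
        simpa [upper, hvA, hkA] using hd
    refine ⟨hv, fun w hw hd => hmax w hw ?_⟩
    refine hd.of_le (le_upper hP w) ?_
    simp [upper, hvA]
  · intro hv
    have hvA := Vtx_subset hP h hv
    refine ⟨hv.1, fun w hw hd => ?_⟩
    simp only [upper, hvA, if_true] at hd
    by_cases hwA : w ∈ A
    · rw [if_pos hwA] at hd
      exact hv.2 w hw hd
    · rw [if_neg hwA] at hd
      rcases h w hw with h | ⟨k, hk, -, hk'⟩
      · exact hwA h
      · exact hv.2 k hk (hk'.trans hd)

theorem vertices_eq (hP : IsRealization Set.univ (original F) P)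
    (h : Resolved F P A (dependent F)) : vertices F P A = Vtx F P := by
  ext v
  rw [vertices, Set.mem_ofPred_eq, OPF_dependent_eq hP h]
  exact and_iff_left_of_imp (Vtx_subset hP h)

theorem mem_staircase_dependent (hP : IsRealization Set.univ (original F) P)
    (h : Resolved F P A (dependent F)) {z : Pt} :
    z ∈ staircase (dependent F) (current F P A) ↔
      (∀ v ∈ Vtx F P, ¬ Dominates (P v) z) ∧ ∃ v ∈ Vtx F P, z ≤ P v := by
  have hO := OPF_dependent_eq hP h
  rw [current_eq_box, mem_staircase_box lower_le_upper, ← current_eq_box, hO]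
  have hu : ∀ v ∈ Vtx F P, upper F P A v = P v := fun v hv => by
    simp [upper, Vtx_subset hP h hv]
  constructor
  · rintro ⟨h1, v, hv, h2⟩
    exact ⟨fun w hw => hu w hw ▸ h1 w hw, v, hv, hu v hv ▸ h2⟩
  · rintro ⟨h1, v, hv, h2⟩
    exact ⟨fun w hw => (hu w hw).symm ▸ h1 w hw, v, hv, (hu v hv).symm ▸ h2⟩

/-- The test of Stage 2 in terms of the final vertices. -/
def Crosses (F : Fin n → Rect) (P : Fin n → Pt) (a : Fin n) : Prop :=
  ∃ z ∈ interior (F a).region ∪ (F a).topFacet ∪ (F a).rightFacet,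
    (∀ v ∈ Vtx F P, ¬ Dominates (P v) z) ∧ ∃ v ∈ Vtx F P, z ≤ P v

theorem crossesStaircase_iff (hP : IsRealization Set.univ (original F) P)
    (h : Resolved F P A (dependent F)) {a : Fin n} :
    CrossesStaircase F P A a ↔ Crosses F P a :=
  exists_congr fun _ => and_congr_right fun _ => mem_staircase_dependent hP h

/-- Some vertex has its first or its second coordinate in the respective range of the region. -/
def Aligned (F : Fin n → Rect) (P : Fin n → Pt) (a : Fin n) : Prop :=
  ∃ v ∈ Vtx F P, ((F a).bl.1 ≤ (P v).1 ∧ (P v).1 ≤ (F a).tr.1) ∨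
    ((F a).bl.2 ≤ (P v).2 ∧ (P v).2 ≤ (F a).tr.2)

theorem Crosses.mem_region {a : Fin n} {z : Pt}
    (hz : z ∈ interior (F a).region ∪ (F a).topFacet ∪ (F a).rightFacet) : z ∈ (F a).region := by
  rcases hz with (hz | hz) | hz
  · exact interior_subset hz
  · exact hz.1
  · exact hz.1

/-- A staircase point lies weakly below a vertex that does not dominate it, hence shares a
coordinate with that vertex. -/
theorem Crosses.aligned {a : Fin n} (h : Crosses F P a) : Aligned F P a := by
  obtain ⟨z, hz, hnd, v, hv, hle⟩ := h
  have hz := Crosses.mem_region hz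
  refine ⟨v, hv, ?_⟩
  have := hnd v hv
  simp only [Dominates, not_and_or, not_lt] at this
  rcases this with h | h
  · exact Or.inl ⟨hz.1.trans hle.1, h.trans hz.2.1⟩
  · exact Or.inr ⟨hz.2.2.1.trans hle.2, h.trans hz.2.2.2⟩

theorem Crosses.not_dominates {a : Fin n} (h : Crosses F P a) {k : Fin n} (hk : k ∈ dependent F) :
    ¬ Dominates (P k) (F a).tr := by
  obtain ⟨z, hz, hnd, -⟩ := h
  have hz := Crosses.mem_region hz
  intro hd
  obtain ⟨v, hv, hd⟩ := exists_Vtx_of_dominates hk hd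
  exact hnd v hv (hd.of_le le_rfl ⟨hz.2.1, hz.2.2.2⟩)

theorem aligned_of_rayHits {a v : Fin n} (hv : v ∈ Vtx F P) (h : RayHits (P v) (F a)) :
    Aligned F P a := by
  refine ⟨v, hv, ?_⟩
  rcases h with ⟨h, ⟨⟨hr, e, -⟩, -⟩, -⟩ | ⟨h, ⟨⟨hr, e, -⟩, -⟩, -⟩
  · exact Or.inl ⟨e ▸ hr.1, e ▸ hr.2.1⟩
  · exact Or.inr ⟨e ▸ hr.2.2.1, e ▸ hr.2.2.2⟩

/-- The hit point is weakly beyond the vertex, so the vertex is weakly below the top-right corner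
and would itself be dominated. -/
theorem not_dominates_of_rayHits {a v : Fin n} (hv : v ∈ Vtx F P) (h : RayHits (P v) (F a))
    {k : Fin n} (hk : k ∈ dependent F) : ¬ Dominates (P k) (F a).tr := by
  intro hd
  refine hv.2 k hk ?_
  rcases h with ⟨h, ⟨⟨hr, e, hle⟩, -⟩, -⟩ | ⟨h, ⟨⟨hr, e, hle⟩, -⟩, -⟩
  · exact hd.of_le le_rfl ⟨e ▸ hr.2.1, hle.trans hr.2.2.2⟩
  · exact hd.of_le le_rfl ⟨hle.trans hr.2.1, e ▸ hr.2.2.2⟩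

/-- Only the points of dependent regions dominate top-right corners. -/
theorem not_dominates_tr (hF : ∀ i, ¬ (F i).region ⊆ IPF Set.univ (original F))
    (hP : IsRealization Set.univ (original F) P) {a : Fin n}
    (h : ∀ k ∈ dependent F, ¬ Dominates (P k) (F a).tr) (j : Fin n) :
    ¬ Dominates (P j) (F a).tr := fun hd =>
  h j (mem_dependent_of_dominates hF (hd.of_le (le_tr_of_realization hP j) le_rfl)) hd

/-- After Stage 1, an unretrieved region whose top-right corner no vertex dominates is on the
outer Pareto front. -/
theorem mem_OPF_univ (hF : ∀ i, ¬ (F i).region ⊆ IPF Set.univ (original F))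
    (hP : IsRealization Set.univ (original F) P) (h : Resolved F P A (dependent F)) {a : Fin n}
    (haA : a ∉ A) (ha : ∀ k ∈ dependent F, ¬ Dominates (P k) (F a).tr) :
    a ∈ OPF Set.univ (current F P A) := by
  refine mem_OPF_current.2 ⟨trivial, fun b _ hd => ?_⟩
  simp only [upper, if_neg haA] at hd
  have hdep := mem_dependent_of_dominates hF (hd.of_le (upper_le_tr (A := A) hP b) le_rfl)
  by_cases hbA : b ∈ A
  · rw [if_pos hbA] at hd
    exact ha b hdep hd
  · rw [if_neg hbA] at hd
    rcases h b hdep with h | ⟨k, hk, -, hk'⟩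
    · exact hbA h
    · exact ha k hk (hk'.trans hd)

/-- The regions of an active layer are not dominated by any actual point, if the earlier layers
have been resolved. -/
theorem activeLayer_not_dominates (hF : ∀ i, ¬ (F i).region ⊆ IPF Set.univ (original F))
    (hP : IsRealization Set.univ (original F) P) {i : ℕ} (h : ∀ j < i, Resolved F P A (layer F j))
    {a : Fin n} (ha : a ∈ activeLayer F P A i) (b : Fin n) :
    ¬ Dominates (upper F P A b) (F a).tr := by
  obtain ⟨hal, hnd, haA⟩ := ha
  rw [isDominated_current_iff hF (remaining_subset_dependent i hal.1) haA] at hnd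
  push Not at hnd
  intro hd
  have hdep := mem_dependent_of_dominates hF (hd.of_le (upper_le_tr (A := A) hP b) le_rfl)
  by_cases hbA : b ∈ A
  · rw [upper, if_pos hbA] at hd
    exact hnd b hdep hbA hd
  · rw [upper, if_neg hbA] at hd
    -- The earlier layer of `b` is resolved, so a retrieved point dominates the corner of `b` and
    -- therefore that of `a`.
    obtain ⟨j, hj, hbj⟩ := exists_earlier_layer hal hdep hd
    rcases h j hj b hbj with h | ⟨k, hk, hkA, hk'⟩
    · exact hbA h
    · exact hnd k hk hkA (hk'.trans hd)

end Strategy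

section Executions

variable {n : ℕ} {F : Fin n → Rect} {P : Fin n → Pt}

/-! ### Termination -/

/-- A bound on the number of the remaining steps. -/
noncomputable def potential (F : Fin n → Rect) : Config n → ℕ
  | ⟨.stage1 i, A⟩ => (numLayers F - i) + Aᶜ.card + 2 * n + 3
  | ⟨.stage2 T, A⟩ => T.ncard + Aᶜ.card + n + 2
  | ⟨.stage3 V, A⟩ => V.ncard + Aᶜ.card + 1
  | ⟨.done, _⟩ => 0

theorem card_compl_insert_le (A : Finset (Fin n)) (a : Fin n) :
    (insert a A)ᶜ.card ≤ Aᶜ.card :=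
  Finset.card_le_card (Finset.compl_subset_compl.2 (Finset.subset_insert a A))

theorem card_compl_insert_lt {A : Finset (Fin n)} {a : Fin n} (ha : a ∉ A) :
    (insert a A)ᶜ.card < Aᶜ.card :=
  Finset.card_lt_card (Finset.compl_ssubset_compl.2 (Finset.ssubset_insert ha))

theorem ncard_le_n (T : Set (Fin n)) : T.ncard ≤ n := by
  simpa using Set.ncard_le_card T

theorem potential_lt {C C' : Config n} (h : Step F P C C') : potential F C' < potential F C := by
  cases h with
  | layerRetrieve i A a hi ha =>
    have := card_compl_insert_lt ha.2.2
    simp only [potential]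
    omega
  | layerNext i A hi h =>
    simp only [potential]
    omega
  | layerEnd i A hi =>
    have := ncard_le_n (independent F)
    simp only [potential]
    omega
  | crossRetrieve T A a haT h =>
    have := card_compl_insert_le A a
    have := Set.ncard_sdiff_singleton_lt_of_mem haT
    simp only [potential]
    omega
  | crossSkip T A a haT h =>
    have := Set.ncard_sdiff_singleton_lt_of_mem haT
    simp only [potential]
    omega
  | crossEnd A =>
    have := ncard_le_n (vertices F P A)
    simp only [potential]
    omega
  | rayRetrieve V A v a hv ha haA h =>
    have := card_compl_insert_lt haA
    simp only [potential]
    omega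
  | rayNext V A v hv h =>
    have := Set.ncard_sdiff_singleton_lt_of_mem hv
    simp only [potential]
    omega
  | rayEnd A =>
    simp only [potential]
    omega

theorem not_exists_infinite_execution :
    ¬ ∃ σ : ℕ → Config n, σ 0 = start ∧ ∀ t, Step F P (σ t) (σ (t + 1)) := by
  rintro ⟨σ, -, hσ⟩
  exact not_strictAnti_of_wellFoundedLT _
    (strictAnti_nat_of_succ_lt (f := fun t => potential F (σ t)) fun t => potential_lt (hσ t))

theorem exists_step (C : Config n) (hC : C.phase ≠ Phase.done) : ∃ C', Step F P C C' := by
  obtain ⟨ph, A⟩ := C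
  cases ph with
  | stage1 i =>
    rcases lt_or_ge i (numLayers F) with hi | hi
    · rcases (activeLayer F P A i).eq_empty_or_nonempty with h | ⟨a, ha⟩
      · exact ⟨_, .layerNext i A hi h⟩
      · exact ⟨_, .layerRetrieve i A a hi ha⟩
    · exact ⟨_, .layerEnd i A hi⟩
  | stage2 T =>
    rcases T.eq_empty_or_nonempty with rfl | ⟨a, ha⟩
    · exact ⟨_, .crossEnd A⟩
    · by_cases h : CrossesStaircase F P A a
      · exact ⟨_, .crossRetrieve T A a ha h⟩
      · exact ⟨_, .crossSkip T A a ha h⟩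
  | stage3 V =>
    rcases V.eq_empty_or_nonempty with rfl | ⟨v, hv⟩
    · exact ⟨_, .rayEnd A⟩
    · by_cases h : ∀ a ∈ independent F, RayHits (P v) (F a) → a ∈ A
      · exact ⟨_, .rayNext V A v hv h⟩
      · push Not at h
        obtain ⟨a, ha, hr, haA⟩ := h
        exact ⟨_, .rayRetrieve V A v a hv ha haA hr⟩
  | done => exact absurd rfl hC

/-! ### Invariants -/

/-- No point of the realization dominates the top-right corner of a retrieved region. -/
def Undominated (F : Fin n → Rect) (P : Fin n → Pt) (A : Finset (Fin n)) : Prop :=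
  ∀ a ∈ A, ∀ j, ¬ Dominates (P j) (F a).tr

theorem Undominated.insert {A : Finset (Fin n)} (h : Undominated F P A) {a : Fin n}
    (ha : ∀ j, ¬ Dominates (P j) (F a).tr) : Undominated F P (insert a A) := by
  intro b hb
  rcases Finset.mem_insert.1 hb with rfl | hb
  · exact ha
  · exact h b hb

/-- What holds for the retrieved regions from the end of Stage 1 on. -/
structure Base (F : Fin n → Rect) (P : Fin n → Pt) (A : Finset (Fin n)) : Prop where
  resolved : Resolved F P A (dependent F)
  undominated : Undominated F P A
  aligned : ∀ a ∈ A, a ∈ independent F → Aligned F P a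

theorem Base.insert {A : Finset (Fin n)} (h : Base F P A) {a : Fin n}
    (h₁ : ∀ j, ¬ Dominates (P j) (F a).tr) (h₂ : Aligned F P a) : Base F P (insert a A) where
  resolved := h.resolved.insert a
  undominated := h.undominated.insert h₁
  aligned b hb hbI := by
    rcases Finset.mem_insert.1 hb with rfl | hb
    · exact h₂
    · exact h.aligned b hb hbI

/-- The invariant of the strategy. -/
def Invariant (F : Fin n → Rect) (P : Fin n → Pt) : Config n → Prop
  | ⟨.stage1 i, A⟩ => (∀ a ∈ A, a ∈ dependent F) ∧ (∀ j < i, Resolved F P A (layer F j)) ∧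
      Undominated F P A
  | ⟨.stage2 T, A⟩ => Base F P A ∧ ∀ a ∈ independent F, Crosses F P a → a ∈ A ∨ a ∈ T
  | ⟨.stage3 V, A⟩ => Base F P A ∧ (∀ a ∈ independent F, Crosses F P a → a ∈ A) ∧
      V ⊆ Vtx F P ∧
      ∀ v ∈ Vtx F P, v ∉ V → ∀ a ∈ independent F, RayHits (P v) (F a) → a ∈ A
  | ⟨.done, A⟩ => Base F P A ∧ (∀ a ∈ independent F, Crosses F P a → a ∈ A) ∧
      ∀ v ∈ Vtx F P, ∀ a ∈ independent F, RayHits (P v) (F a) → a ∈ A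

theorem Invariant.step (hF : ∀ i, ¬ (F i).region ⊆ IPF Set.univ (original F))
    (hP : IsRealization Set.univ (original F) P) {C C' : Config n} (hC : Invariant F P C)
    (h : Step F P C C') : Invariant F P C' := by
  cases h with
  | layerRetrieve i A a hi ha =>
    obtain ⟨h1, h2, h3⟩ := hC
    refine ⟨fun b hb => ?_, fun j hj => (h2 j hj).insert a, h3.insert fun j hd => ?_⟩
    · rcases Finset.mem_insert.1 hb with rfl | hb
      · exact remaining_subset_dependent i ha.1.1
      · exact h1 b hb
    · exact activeLayer_not_dominates hF hP h2 ha j (hd.of_le (le_upper hP j) le_rfl)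
  | layerNext i A hi h =>
    obtain ⟨h1, h2, h3⟩ := hC
    refine ⟨h1, fun j hj => ?_, h3⟩
    rcases Nat.lt_succ_iff_lt_or_eq.1 hj with hj | rfl
    · exact h2 j hj
    · exact resolved_layer_of_activeLayer_eq_empty hF h
  | layerEnd i A hi =>
    obtain ⟨h1, h2, h3⟩ := hC
    refine ⟨⟨fun a ha => ?_, h3, fun a ha haI => absurd haI (h1 a ha)⟩, fun a ha _ => Or.inr ha⟩
    obtain ⟨j, hj, haj⟩ := exists_layer ha
    exact h2 j (hj.trans_le hi) a haj
  | crossRetrieve T A a haT h =>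
    obtain ⟨h1, h2⟩ := hC
    rw [crossesStaircase_iff hP h1.resolved] at h
    refine ⟨h1.insert (not_dominates_tr hF hP fun k hk => h.not_dominates hk) h.aligned,
      fun b hb hbc => ?_⟩
    rcases eq_or_ne b a with rfl | hba
    · exact Or.inl (Finset.mem_insert_self _ _)
    · exact (h2 b hb hbc).imp (Finset.mem_insert_of_mem ·) fun hbT => ⟨hbT, hba⟩
  | crossSkip T A a haT h =>
    obtain ⟨h1, h2⟩ := hC
    rw [crossesStaircase_iff hP h1.resolved] at h
    refine ⟨h1, fun b hb hbc => (h2 b hb hbc).imp_right fun hbT => ⟨hbT, ?_⟩⟩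
    rintro rfl
    exact h hbc
  | crossEnd A =>
    obtain ⟨h1, h2⟩ := hC
    rw [vertices_eq hP h1.resolved]
    exact ⟨h1, fun a ha hac => (h2 a ha hac).resolve_right id, subset_rfl,
      fun v hv hv' => absurd hv hv'⟩
  | rayRetrieve V A v a hv ha haA h =>
    obtain ⟨h1, h2, h3, h4⟩ := hC
    exact ⟨h1.insert (not_dominates_tr hF hP fun k hk => not_dominates_of_rayHits (h3 hv) h hk)
        (aligned_of_rayHits (h3 hv) h),
      fun b hb hbc => Finset.mem_insert_of_mem (h2 b hb hbc), h3,
      fun w hw hwV b hb hbr => Finset.mem_insert_of_mem (h4 w hw hwV b hb hbr)⟩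
  | rayNext V A v hv h =>
    obtain ⟨h1, h2, h3, h4⟩ := hC
    refine ⟨h1, h2, Set.sdiff_subset.trans h3, fun w hw hwV b hb hbr => ?_⟩
    rcases eq_or_ne w v with rfl | hwv
    · exact h b hb hbr
    · exact h4 w hw (fun hm => hwV ⟨hm, hwv⟩) b hb hbr
  | rayEnd A =>
    obtain ⟨h1, h2, h3, h4⟩ := hC
    exact ⟨h1, h2, fun v hv => h4 v hv id⟩

theorem invariant_of_reachable (hF : ∀ i, ¬ (F i).region ⊆ IPF Set.univ (original F))
    (hP : IsRealization Set.univ (original F) P) {C : Config n} (hC : Reachable F P C) :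
    Invariant F P C := by
  induction hC with
  | refl => exact ⟨by simp, by simp, by simp [Undominated]⟩
  | tail _ h ih => exact ih.step hF hP h

theorem of_reachable_done {A : Finset (Fin n)}
    (hF : ∀ i, ¬ (F i).region ⊆ IPF Set.univ (original F))
    (hP : IsRealization Set.univ (original F) P) (hA : Reachable F P ⟨.done, A⟩) :
    Base F P A ∧ (∀ a ∈ independent F, Crosses F P a → a ∈ A) ∧
      ∀ v ∈ Vtx F P, ∀ a ∈ independent F, RayHits (P v) (F a) → a ∈ A :=
  invariant_of_reachable hF hP hA

theorem activeLayer_subset_OPF (hF : ∀ i, ¬ (F i).region ⊆ IPF Set.univ (original F))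
    (hP : IsRealization Set.univ (original F) P) {i : ℕ} {A : Finset (Fin n)}
    (hC : Invariant F P ⟨.stage1 i, A⟩) {J : Set (Fin n)} {a : Fin n}
    (ha : a ∈ activeLayer F P A i) (haJ : a ∈ J) : a ∈ OPF J (current F P A) := by
  refine mem_OPF_current.2 ⟨haJ, fun b _ hd => ?_⟩
  rw [upper, upper, if_neg ha.2.2, ← upper] at hd
  exact activeLayer_not_dominates hF hP hC.2.1 ha b hd

theorem retrieved_mem_OPF (hF : ∀ i, ¬ (F i).region ⊆ IPF Set.univ (original F))
    (hP : IsRealization Set.univ (original F) P) {C C' : Config n} (hC : Invariant F P C)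
    (h : Step F P C C') {a : Fin n} (ha : a ∈ C'.retrieved \ C.retrieved) :
    a ∈ OPF Set.univ (current F P C.retrieved) := by
  have hins : ∀ {A : Finset (Fin n)} {b : Fin n}, a ∈ insert b A \ A → a = b ∧ a ∉ A := by
    intro A b h
    obtain ⟨h1, h2⟩ := Finset.mem_sdiff.1 h
    exact ⟨(Finset.mem_insert.1 h1).resolve_right h2, h2⟩
  cases h with
  | layerRetrieve i A b hi hb =>
    obtain ⟨rfl, -⟩ := hins ha
    exact activeLayer_subset_OPF hF hP hC hb trivial
  | crossRetrieve T A b hbT h =>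
    obtain ⟨rfl, haA⟩ := hins ha
    rw [crossesStaircase_iff hP hC.1.resolved] at h
    exact mem_OPF_univ hF hP hC.1.resolved haA fun k hk => h.not_dominates hk
  | rayRetrieve V A v b hv hb hbA h =>
    obtain ⟨rfl, haA⟩ := hins ha
    exact mem_OPF_univ hF hP hC.1.resolved haA fun k hk =>
      not_dominates_of_rayHits (hC.2.2.1 hv) h hk
  | layerNext | layerEnd | crossSkip | crossEnd | rayNext | rayEnd => simp at ha

end Executions

/-! ### The family is finished on termination -/

section Result

variable {n : ℕ} {F : Fin n → Rect} {P : Fin n → Pt} {A : Finset (Fin n)}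

theorem mem_interior_region {R : Rect} {z : Pt} (h₁ : Dominates z R.bl) (h₂ : Dominates R.tr z) :
    z ∈ interior R.region := by
  have ho : IsOpen {z : Pt | (R.bl.1 < z.1 ∧ R.bl.2 < z.2) ∧ z.1 < R.tr.1 ∧ z.2 < R.tr.2} :=
    (((isOpen_lt continuous_const continuous_fst).inter
      (isOpen_lt continuous_const continuous_snd))).inter
    ((isOpen_lt continuous_fst continuous_const).inter
      (isOpen_lt continuous_snd continuous_const))
  refine interior_maximal (fun w hw => ?_) ho ⟨h₁, h₂⟩
  obtain ⟨⟨l1, l2⟩, u1, u2⟩ := hw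
  exact ⟨l1.le, u1.le, l2.le, u2.le⟩

/-- If a vertex dominates the bottom-left corner but no vertex dominates the top-right corner, then
the diagonal of the region meets the staircase. -/
theorem crosses_of_dominates_bl {a v : Fin n} (hv : v ∈ Vtx F P) (hd : Dominates (P v) (F a).bl)
    (hn : ∀ v ∈ Vtx F P, ¬ Dominates (P v) (F a).tr) : Crosses F P a := by
  set l := (F a).bl with hl
  set w := (F a).tr.1 - l.1 with hw
  set h := (F a).tr.2 - l.2 with hh
  have hw0 : 0 < w := sub_pos.2 (F a).width_pos
  have hh0 : 0 < h := sub_pos.2 (F a).height_pos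
  -- `T v` is the largest parameter at which the diagonal point `l + t * (w, h)` is still weakly
  -- below `P v`; the maximum over the vertices is where the diagonal meets the staircase.
  let T : Fin n → ℝ := fun v => min (((P v).1 - l.1) / w) (((P v).2 - l.2) / h)
  obtain ⟨u, hu, hmax⟩ := Set.exists_max_image (Vtx F P) T (Set.toFinite _) ⟨v, hv⟩
  have hle : ∀ t v, t ≤ T v ↔ l.1 + t * w ≤ (P v).1 ∧ l.2 + t * h ≤ (P v).2 := by
    intro t v
    rw [le_min_iff, le_div_iff₀ hw0, le_div_iff₀ hh0, le_sub_iff_add_le', le_sub_iff_add_le']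
  have hlt : ∀ t v, t < T v ↔ l.1 + t * w < (P v).1 ∧ l.2 + t * h < (P v).2 := by
    intro t v
    rw [lt_min_iff, lt_div_iff₀ hw0, lt_div_iff₀ hh0, lt_sub_iff_add_lt', lt_sub_iff_add_lt']
  have h0 : 0 < T u := by
    refine lt_of_lt_of_le ((hlt 0 v).2 ?_) (hmax v hv)
    simpa [Dominates] using hd
  have h1 : T u ≤ 1 := by
    rw [← not_lt, hlt, one_mul, one_mul, hw, hh, add_sub_cancel, add_sub_cancel]
    exact hn u hu
  have e1 : l.1 + w = (F a).tr.1 := by rw [hw]; ring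
  have e2 : l.2 + h = (F a).tr.2 := by rw [hh]; ring
  refine ⟨(l.1 + T u * w, l.2 + T u * h), ?_, fun x hx hdx => ?_, u, hu, (hle _ u).1 le_rfl⟩
  · rcases h1.lt_or_eq with h1 | h1
    · refine Or.inl (Or.inl (mem_interior_region ⟨?_, ?_⟩ ⟨?_, ?_⟩))
      · show l.1 < l.1 + T u * w
        linarith [mul_pos h0 hw0]
      · show l.2 < l.2 + T u * h
        linarith [mul_pos h0 hh0]
      · show l.1 + T u * w < (F a).tr.1
        rw [← e1]
        linarith [(mul_lt_iff_lt_one_left hw0).2 h1]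
      · show l.2 + T u * h < (F a).tr.2
        rw [← e2]
        linarith [(mul_lt_iff_lt_one_left hh0).2 h1]
    -- At parameter 1 the meeting point is the top-right corner, which is not interior but on the
    -- top facet.
    · refine Or.inl (Or.inr ?_)
      rw [h1, one_mul, one_mul, e1, e2]
      exact ⟨tr_mem _, rfl⟩
  · exact not_le.2 ((hlt _ x).2 hdx) (hmax x hx)

/-- An independent region whose bottom-left corner no vertex dominates does not meet the inner
Pareto front. -/
theorem not_dominates_bl (hF : ∀ i, ¬ (F i).region ⊆ IPF Set.univ (original F))
    (hP : IsRealization Set.univ (original F) P) {a : Fin n} (ha : a ∈ independent F)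
    (hn : ∀ v ∈ Vtx F P, ¬ Dominates (P v) (F a).bl) (k : Fin n) :
    ¬ Dominates (F k).bl (F a).bl := by
  intro hk
  -- The point of such a `j` would force a vertex to dominate the bottom-left corner of `a`. It
  -- remains to choose an extremal `j` that depends on `a`.
  suffices h : ∃ j ∈ dependent F, Dominates (F j).bl (F a).bl by
    obtain ⟨j, hj, hd⟩ := h
    obtain ⟨v, hv, hd⟩ := exists_Vtx_of_dominates hj (hd.of_le (bl_le_of_realization hP j) le_rfl)
    exact hn v hv hd
  have hwa := (F a).width_pos
  have hha := (F a).height_pos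
  by_cases hA : ∃ k, Dominates (F k).bl (F a).bl ∧ (F a).tr.2 < (F k).bl.2
  · obtain ⟨k, hk, hk2⟩ := hA
    -- Among the regions entirely above `a`, take the one with the rightmost left side. That side
    -- meets the top facet of `a` in a point outside the inner front, since a corner dominating it
    -- would be farther right.
    obtain ⟨j, hj, hmax⟩ := Set.exists_max_image {k | (F a).tr.2 < (F k).bl.2}
      (fun k => (F k).bl.1) (Set.toFinite _) ⟨k, hk2⟩
    have hj2 : (F a).tr.2 < (F j).bl.2 := hj
    have hkj := hmax k hk2
    have hj1 : (F j).bl.1 ≤ (F a).tr.1 := by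
      by_contra! h
      exact tr_not_dominated hF a j ⟨h, hj2⟩
    have hwj := (F j).width_pos
    have hhj := (F j).height_pos
    have hk1 := hk.1
    refine ⟨j, ?_, by linarith, by linarith⟩
    refine mem_dependent_of (b := a) (q := ((F j).bl.1, (F a).tr.2)) ?_ ?_ ?_ ?_ (Or.inr ⟨?_, ?_⟩)
    · rintro rfl
      linarith
    · exact ⟨by linarith, hj1, hha.le, le_rfl⟩
    · rintro ⟨-, h⟩
      linarith
    · rintro i ⟨h1, h2⟩
      exact not_le.2 h1 (hmax i h2)
    · exact hwj
    · exact hj2.trans hhj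
  · push Not at hA
    -- Now all dominating corners are at most as high as the top of `a`. The height of the highest
    -- one marks a point on the left facet of `a` that is outside the inner front.
    obtain ⟨j, hj, hmax⟩ := Set.exists_max_image {k | Dominates (F k).bl (F a).bl}
      (fun k => (F k).bl.2) (Set.toFinite _) ⟨k, hk⟩
    have hj' : Dominates (F j).bl (F a).bl := hj
    have hwj := (F j).width_pos
    have hhj := (F j).height_pos
    refine ⟨j, ?_, hj'⟩
    refine mem_dependent_of (b := a) (q := ((F a).bl.1, (F j).bl.2)) ?_ ?_ ?_ ?_ (Or.inr ⟨?_, ?_⟩)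
    · rintro rfl
      exact Dominates.irrefl _ hj'
    · exact ⟨le_rfl, hwa.le, hj'.2.le, hA j hj'⟩
    · intro h
      exact mem_dependent_of_dominates hF h ha
    · rintro i ⟨h1, h2⟩
      exact not_le.2 h2 (hmax i ⟨h1, hj'.2.trans h2⟩)
    · exact hj'.1.trans hwj
    · exact hhj

theorem upwardHit_of_mem {p : Pt} {R : Rect} (h : p ∈ R.region) : UpwardHit p R p :=
  ⟨⟨h, rfl, le_rfl⟩, fun _ _ _ h => h⟩

theorem rightwardHit_of_mem {p : Pt} {R : Rect} (h : p ∈ R.region) : RightwardHit p R p :=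
  ⟨⟨h, rfl, le_rfl⟩, fun _ _ _ h => h⟩

/-- Each ray has one excluded corner, and the two corners differ, so a vertex inside the rectangle
always hits by one of its rays. -/
theorem rayHits_of_mem {p : Pt} {R : Rect} (h : p ∈ R.region) : RayHits p R := by
  by_cases hb : p = R.br
  · refine Or.inr ⟨p, rightwardHit_of_mem h, fun ht => ?_⟩
    rw [hb] at ht
    have e : R.tr.1 = R.bl.1 := (Prod.ext_iff.1 ht).1
    exact R.width_pos.ne' e
  · exact Or.inl ⟨p, upwardHit_of_mem h, hb⟩

/-- If `p` were not strictly left of the rectangle, its upward ray would hit at an abscissa below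
that of the right side, so not in the excluded corner; the rightward ray is symmetric. -/
theorem dominates_bl_of_not_rayHits {p : Pt} {R : Rect} (hd : Dominates R.tr p)
    (h : ¬ RayHits p R) : Dominates R.bl p := by
  have hw := R.width_pos
  have hh := R.height_pos
  by_contra hcon
  simp only [Dominates, not_and_or, not_lt] at hcon
  apply h
  rcases hcon with h1 | h2
  · refine Or.inl ⟨(p.1, max p.2 R.bl.2), ⟨⟨⟨h1, hd.1.le, le_max_right _ _, ?_⟩, rfl,
      le_max_left _ _⟩, fun w hw _ hpw => max_le hpw hw.2.2.1⟩, fun e => ?_⟩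
    · exact max_le hd.2.le hh.le
    · have e' : p.1 = R.tr.1 := (Prod.ext_iff.1 e).1
      exact hd.1.ne e'
  · refine Or.inr ⟨(max p.1 R.bl.1, p.2), ⟨⟨⟨le_max_right _ _, ?_, h2, hd.2.le⟩, rfl,
      le_max_left _ _⟩, fun w hw _ hpw => max_le hpw hw.1⟩, fun e => ?_⟩
    · exact max_le hd.1.le hw.le
    · have e' : p.2 = R.tr.2 := (Prod.ext_iff.1 e).2
      exact hd.2.ne e'

/-- An unretrieved independent region that is certainly on the Pareto front. -/
structure Free (F : Fin n → Rect) (P : Fin n → Pt) (A : Finset (Fin n)) (a : Fin n) : Prop where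
  notMem : a ∉ A
  indep : a ∈ independent F
  not_vtx : ∀ v ∈ Vtx F P, ¬ Dominates (P v) (F a).bl
  not_bl : ∀ k, ¬ Dominates (F k).bl (F a).bl
  not_ray : ∀ v ∈ Vtx F P, ¬ RayHits (P v) (F a)

/-- The properties of the set of the retrieved regions on termination. -/
structure Final (F : Fin n → Rect) (P : Fin n → Pt) (A : Finset (Fin n)) : Prop where
  notSubset : ∀ i, ¬ (F i).region ⊆ IPF Set.univ (original F)
  real : IsRealization Set.univ (original F) P
  resolved : Resolved F P A (dependent F)
  crosses : ∀ a ∈ independent F, Crosses F P a → a ∈ A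
  ray : ∀ v ∈ Vtx F P, ∀ a ∈ independent F, RayHits (P v) (F a) → a ∈ A

theorem mem_region_of_current {Q : Fin n → Pt} (hP : IsRealization Set.univ (original F) P)
    (hQ : IsRealization Set.univ (current F P A) Q) (i : Fin n) : Q i ∈ (F i).region := by
  have := hQ i trivial
  unfold current at this
  split_ifs at this
  · rw [Set.mem_singleton_iff.1 this]
    exact hP i trivial
  · exact this

theorem eq_of_current {Q : Fin n → Pt} (hQ : IsRealization Set.univ (current F P A) Q)
    {i : Fin n} (hi : i ∈ A) : Q i = P i := by
  have := hQ i trivial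
  rwa [current, if_pos hi] at this

namespace Final

variable {Q Q' : Fin n → Pt}

/-- Unretrieved regions are harmless for one of two opposite reasons: they are certainly off the
front or certainly on it. -/
theorem free_or (h : Final F P A) {i : Fin n} (hi : i ∉ A) :
    Free F P A i ∨ ∃ k ∈ dependent F, k ∈ A ∧ Dominates (P k) (F i).tr := by
  by_cases hI : i ∈ dependent F
  · exact Or.inr ((h.resolved i hI).resolve_left hi)
  · have hI' : i ∈ independent F := not_not.1 hI
    by_cases hd : ∃ v ∈ Vtx F P, Dominates (P v) (F i).tr
    · obtain ⟨v, hv, hd⟩ := hd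
      exact Or.inr ⟨v, hv.1, Vtx_subset h.real h.resolved hv, hd⟩
    · push Not at hd
      have hn : ∀ v ∈ Vtx F P, ¬ Dominates (P v) (F i).bl := fun v hv hvd =>
        hi (h.crosses i hI' (crosses_of_dominates_bl hv hvd hd))
      exact Or.inl ⟨hi, hI', hn, not_dominates_bl h.notSubset h.real hI' hn,
        fun v hv hr => hi (h.ray v hv i hI' hr)⟩

/-- A dominating point of a dependent region would yield a vertex dominating the bottom-left corner
of `i`. One of an independent region would give that region a dependency on `i`, certified by `Q i`.
-/
theorem mem_PF_of_free (h : Final F P A) {i : Fin n} (hi : Free F P A i)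
    (hQ : IsRealization Set.univ (current F P A) Q) : i ∈ PF Set.univ Q := by
  refine ⟨trivial, fun j _ hd => ?_⟩
  have hji : j ≠ i := by
    rintro rfl
    exact Dominates.irrefl _ hd
  have hQi := mem_region_of_current h.real hQ i
  have hQj := mem_region_of_current h.real hQ j
  by_cases hj : j ∈ dependent F
  · have : ∃ k ∈ dependent F, Dominates (P k) (Q i) := by
      by_cases hjA : j ∈ A
      · exact ⟨j, hj, eq_of_current hQ hjA ▸ hd⟩
      · obtain ⟨k, hk, -, hkd⟩ := (h.resolved j hj).resolve_left hjA
        exact ⟨k, hk, hkd.trans (hd.of_le ⟨hQj.2.1, hQj.2.2.2⟩ le_rfl)⟩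
    obtain ⟨k, hk, hkd⟩ := this
    obtain ⟨v, hv, hvd⟩ := exists_Vtx_of_dominates hk hkd
    exact hi.not_vtx v hv (hvd.of_le le_rfl ⟨hQi.1, hQi.2.2.1⟩)
  · refine hj (mem_dependent_of hji.symm hQi (fun hd' => ?_) (fun k hk => ?_) (Or.inr ?_))
    · exact mem_dependent_of_dominates h.notSubset hd' hi.indep
    · exact hi.not_bl k (hk.of_le le_rfl ⟨hQi.1, hQi.2.2.1⟩)
    · exact hd.of_le ⟨hQj.2.1, hQj.2.2.2⟩ le_rfl

theorem mem_Vtx_of_mem_PF (h : Final F P A) {i : Fin n} (hi : i ∈ dependent F) (hiA : i ∈ A)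
    (hQ : IsRealization Set.univ (current F P A) Q) (hPF : i ∈ PF Set.univ Q) : i ∈ Vtx F P := by
  refine ⟨hi, fun w hw hd => ?_⟩
  have : ∃ k ∈ A, Dominates (P k) (P i) := by
    rcases h.resolved w hw with hwA | ⟨k, -, hkA, hk⟩
    · exact ⟨w, hwA, hd⟩
    · exact ⟨k, hkA, hk.trans (hd.of_le (le_tr_of_realization h.real w) le_rfl)⟩
  obtain ⟨k, hkA, hk⟩ := this
  refine hPF.2 k trivial ?_
  rwa [eq_of_current hQ hkA, eq_of_current hQ hiA]

theorem not_IPF_of_mem_PF (h : Final F P A) (hQ : IsRealization Set.univ (current F P A) Q)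
    {i : Fin n} (hPF : i ∈ PF Set.univ Q) (k : Fin n) : ¬ Dominates (F k).bl (Q i) := by
  have hk := mem_region_of_current h.real hQ k
  exact fun hd => hPF.2 k trivial (hd.of_le ⟨hk.1, hk.2.2.1⟩ le_rfl)

theorem free_of_mem_PF (h : Final F P A) (hQ : IsRealization Set.univ (current F P A) Q)
    {i : Fin n} (hi : i ∉ A) (hPF : i ∈ PF Set.univ Q) : Free F P A i := by
  refine (h.free_or hi).resolve_right fun ⟨k, _, hkA, hk⟩ => ?_
  have hQi := mem_region_of_current h.real hQ i
  refine hPF.2 k trivial ?_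
  rw [eq_of_current hQ hkA]
  exact hk.of_le le_rfl ⟨hQi.2.1, hQi.2.2.2⟩

/-- Only a retrieved `i` and a free `j` need an argument. If `i` is a vertex, a missing ray hit
means that `j` dominates it in every realization or in none. If `i` is independent, `P i` would
certify a dependency of `j` on `i`. -/
theorem mem_PF (h : Final F P A) (hQ : IsRealization Set.univ (current F P A) Q)
    (hQ' : IsRealization Set.univ (current F P A) Q') {i : Fin n} (hPF : i ∈ PF Set.univ Q) :
    i ∈ PF Set.univ Q' := by
  by_cases hiA : i ∈ A
  swap
  · exact h.mem_PF_of_free (h.free_of_mem_PF hQ hiA hPF) hQ'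
  have hQi := eq_of_current hQ hiA
  refine ⟨trivial, fun j _ hd => ?_⟩
  rw [eq_of_current hQ' hiA] at hd
  have hQj' := mem_region_of_current h.real hQ' j
  have hQj := mem_region_of_current h.real hQ j
  have htr : Dominates (F j).tr (P i) := hd.of_le ⟨hQj'.2.1, hQj'.2.2.2⟩ le_rfl
  have hij : i ≠ j := by
    rintro rfl
    rw [eq_of_current hQ' hiA] at hd
    exact Dominates.irrefl _ hd
  by_cases hjA : j ∈ A
  · refine hPF.2 j trivial ?_
    rwa [hQi, eq_of_current hQ hjA, ← eq_of_current hQ' hjA]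
  · rcases h.free_or hjA with hj | ⟨k, -, hkA, hk⟩
    · by_cases hi : i ∈ dependent F
      · have hv := h.mem_Vtx_of_mem_PF hi hiA hQ hPF
        have := dominates_bl_of_not_rayHits htr (hj.not_ray i hv)
        refine hPF.2 j trivial ?_
        rw [hQi]
        exact this.of_le ⟨hQj.1, hQj.2.2.1⟩ le_rfl
      · refine mem_dependent_of hij (h.real i trivial) (fun hd' => ?_) (fun k hk => ?_)
          (Or.inr htr) hj.indep
        · exact hi (mem_dependent_of_dominates h.notSubset hd')
        · exact h.not_IPF_of_mem_PF hQ hPF k (hQi ▸ hk)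
    · refine hPF.2 k trivial ?_
      rw [hQi, eq_of_current hQ hkA]
      exact hk.trans htr

/-- A free region is disjoint from the current regions of the other points on the front. -/
theorem disjoint_of_free (h : Final F P A) {c d : Fin n} (hc : Free F P A c) (hdc : d ≠ c)
    (hQ : IsRealization Set.univ (current F P A) Q) (hPF : d ∈ PF Set.univ Q) {z : Pt}
    (hz : z ∈ (F c).region) : z ∉ current F P A d := by
  intro hzd
  have hzI : ∀ k, ¬ Dominates (F k).bl z := fun k hk =>
    hc.not_bl k (hk.of_le le_rfl ⟨hz.1, hz.2.2.1⟩)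
  by_cases hd : d ∈ dependent F
  · have hdA : d ∈ A := by
      by_contra hdA
      exact hd (h.free_of_mem_PF hQ hdA hPF).indep
    rw [current, if_pos hdA, Set.mem_singleton_iff] at hzd
    exact hc.not_ray d (h.mem_Vtx_of_mem_PF hd hdA hQ hPF) (rayHits_of_mem (hzd ▸ hz))
  · have hzr : z ∈ (F d).region := by
      unfold current at hzd
      split_ifs at hzd
      · rw [Set.mem_singleton_iff.1 hzd]
        exact h.real d trivial
      · exact hzd
    refine mem_dependent_of hdc hzr (fun hd' => ?_) hzI (Or.inl hz) hc.indep
    exact hd (mem_dependent_of_dominates h.notSubset hd')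

end Final

/-- The order of two points on the front does not change while they stay in disjoint boxes. -/
theorem frontOrder_of_disjoint {lo hi : Fin n → Pt} {Q Q' : Fin n → Pt}
    (hle : ∀ i, lo i ≤ hi i)
    (hQ : IsRealization Set.univ (fun i => box (lo i) (hi i)) Q)
    (hQ' : IsRealization Set.univ (fun i => box (lo i) (hi i)) Q') {a b : Fin n}
    (hdis : ∀ z ∈ box (lo a) (hi a), z ∉ box (lo b) (hi b)) (ha' : a ∈ PF Set.univ Q')
    (hb' : b ∈ PF Set.univ Q') (h : FrontOrder Set.univ Q a b) : FrontOrder Set.univ Q' a b := by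
  obtain ⟨ha, hb, hord⟩ := h
  refine ⟨ha', hb', ?_⟩
  have n1 := ha.2 b trivial
  have n2 := hb.2 a trivial
  have n1' := ha'.2 b trivial
  have n2' := hb'.2 a trivial
  simp only [Dominates, not_and_or, not_lt] at n1 n2 n1' n2'
  obtain ⟨a1, a2, a3, a4⟩ := hQ a trivial
  obtain ⟨b1, b2, b3, b4⟩ := hQ b trivial
  obtain ⟨a1', a2', a3', a4'⟩ := hQ' a trivial
  obtain ⟨b1', b2', b3', b4'⟩ := hQ' b trivial
  -- Boxes that overlap in both projections share the maximum of their lower corners. Of the four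
  -- separations, the two that would put `b` before `a` contradict the order in `Q`.
  have hsep : (hi a).1 < (lo b).1 ∨ (hi b).1 < (lo a).1 ∨ (hi a).2 < (lo b).2 ∨
      (hi b).2 < (lo a).2 := by
    by_contra! hcon
    obtain ⟨c1, c2, c3, c4⟩ := hcon
    refine hdis (max (lo a).1 (lo b).1, max (lo a).2 (lo b).2)
      ⟨le_max_left _ _, max_le (hle a).1 c1, le_max_left _ _, max_le (hle a).2 c3⟩
      ⟨le_max_right _ _, max_le c2 (hle b).1, le_max_right _ _, max_le c4 (hle b).2⟩
  rcases hsep with h | h | h | h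
  · left; linarith
  · exfalso
    rcases hord with h' | h' <;> rcases n1 with n1 | n1 <;> rcases n2 with n2 | n2 <;> linarith
  · exfalso
    rcases hord with h' | h' <;> rcases n1 with n1 | n1 <;> rcases n2 with n2 | n2 <;> linarith
  · right; linarith

theorem Final.frontOrder (h : Final F P A) {Q Q' : Fin n → Pt}
    (hQ : IsRealization Set.univ (current F P A) Q)
    (hQ' : IsRealization Set.univ (current F P A) Q') {a b : Fin n}
    (hab : FrontOrder Set.univ Q a b) : FrontOrder Set.univ Q' a b := by
  have ha' := h.mem_PF hQ hQ' hab.1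
  have hb' := h.mem_PF hQ hQ' hab.2.1
  by_cases hAA : a ∈ A ∧ b ∈ A
  · refine ⟨ha', hb', ?_⟩
    rw [eq_of_current hQ' hAA.1, eq_of_current hQ' hAA.2, ← eq_of_current hQ hAA.1,
      ← eq_of_current hQ hAA.2]
    exact hab.2.2
  · have hne : a ≠ b := by
      rintro rfl
      simpa using hab.2.2
    have hdis : ∀ z ∈ current F P A a, z ∉ current F P A b := by
      intro z hza hzb
      rcases not_and_or.1 hAA with hA | hA
      · have hfree := h.free_of_mem_PF hQ hA hab.1
        rw [current, if_neg hA] at hza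
        exact h.disjoint_of_free hfree hne.symm hQ hab.2.1 hza hzb
      · have hfree := h.free_of_mem_PF hQ hA hab.2.1
        rw [current, if_neg hA] at hzb
        exact h.disjoint_of_free hfree hne hQ hab.1 hzb hza
    rw [current_eq_box] at hQ hQ' hdis
    exact frontOrder_of_disjoint lower_le_upper hQ hQ' hdis ha' hb' hab

theorem Final.finished (h : Final F P A) : Finished Set.univ (current F P A) :=
  fun _ _ h₁ h₂ _ _ => ⟨h.frontOrder h₁ h₂, h.frontOrder h₂ h₁⟩

end Result

/-! ### Charging the retrieved regions to an arbitrary finishing set -/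

section LowerBound

variable {n : ℕ} {F : Fin n → Rect} {P : Fin n → Pt} {B : Finset (Fin n)}

/-- The unretrieved regions whose top-right corner no retrieved point dominates. -/
def Alive (F : Fin n → Rect) (P : Fin n → Pt) (B : Finset (Fin n)) (a : Fin n) : Prop :=
  a ∉ B ∧ ∀ k ∈ B, ¬ Dominates (P k) (F a).tr

theorem Alive.not_dominates_lower (hF : ∀ i, ¬ (F i).region ⊆ IPF Set.univ (original F))
    {a : Fin n} (ha : Alive F P B a) (k : Fin n) :
    ¬ Dominates (lower F P B k) (upper F P B a) := by
  simp only [upper, if_neg ha.1]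
  unfold lower
  split_ifs with hk
  · exact ha.2 k hk
  · exact tr_not_dominated hF a k

/-- `a` lies weakly above and to the left of `b`. -/
def UpperLeft (F : Fin n → Rect) (a b : Fin n) : Prop :=
  (F a).tr.1 ≤ (F b).bl.1 ∧ (F b).tr.2 ≤ (F a).bl.2

/-- In a finished family, a region that is not dominated and another region that is not dominated
are separated by an antidiagonal. -/
theorem separated_of_finished (hF : ∀ i, ¬ (F i).region ⊆ IPF Set.univ (original F))
    (hfin : Finished Set.univ (current F P B)) {a j : Fin n} (ha : Alive F P B a) (hja : j ≠ a)
    (hj : ∀ k, ¬ Dominates (lower F P B k) (upper F P B j)) :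
    ((upper F P B j).1 ≤ (F a).bl.1 ∧ (F a).tr.2 ≤ (lower F P B j).2) ∨
      ((F a).tr.1 ≤ (lower F P B j).1 ∧ (upper F P B j).2 ≤ (F a).bl.2) := by
  rw [current_eq_box] at hfin
  have h1 := not_dominates_of_finished lower_le_upper hfin hja (ha.not_dominates_lower hF)
  have h2 := not_dominates_of_finished lower_le_upper hfin hja.symm hj
  have hlu := lower_le_upper (F := F) (P := P) (A := B) j
  have l1 := hlu.1
  have l2 := hlu.2
  rw [lower, if_neg ha.1] at h1
  rw [upper, if_neg ha.1] at h2
  have hw := (F a).width_pos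
  have hh := (F a).height_pos
  simp only [Dominates, not_and_or, not_lt] at h1 h2
  -- If both failures of domination concern the same coordinate, `a` would have no width or no
  -- height.
  rcases h1 with h1 | h1 <;> rcases h2 with h2 | h2
  · linarith
  · exact Or.inl ⟨h1, h2⟩
  · exact Or.inr ⟨h2, h1⟩
  · linarith

theorem upperLeft_or (hF : ∀ i, ¬ (F i).region ⊆ IPF Set.univ (original F))
    (hfin : Finished Set.univ (current F P B)) {a b : Fin n} (ha : Alive F P B a)
    (hb : Alive F P B b) (hab : a ≠ b) : UpperLeft F a b ∨ UpperLeft F b a := by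
  have := separated_of_finished hF hfin ha hab.symm (hb.not_dominates_lower hF)
  simp only [upper, lower, if_neg hb.1] at this
  exact this.symm

/-- `q` certifies that the region `a` has an outgoing dependency. -/
def Certifies (F : Fin n → Rect) (a : Fin n) (q : Pt) : Prop :=
  (∀ k, ¬ Dominates (F k).bl q) ∧ (q ∈ (F a).region ∨ Dominates (F a).tr q)

/-- The six ways in which a region can be charged to a point `w`. -/
def Charge (F : Fin n → Rect) (w : Pt) (a : Fin n) : Fin 6 → Prop
  | 0 => (F a).bl.1 ≤ w.1 ∧ w.1 < (F a).tr.1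
  | 1 => w.1 = (F a).tr.1
  | 2 => w.1 < (F a).bl.1 ∧ ∃ q, Certifies F a q ∧ q.1 ≤ w.1
  | 3 => (F a).bl.2 ≤ w.2 ∧ w.2 < (F a).tr.2
  | 4 => w.2 = (F a).tr.2
  | 5 => w.2 < (F a).bl.2 ∧ ∃ q, Certifies F a q ∧ q.2 ≤ w.2

/-- The half-open projections of chain members are disjoint, and their right and top sides differ.
In kind 2, the certificate of `b` lies left of both regions and below the top of `b`, so the
bottom-left corner of `a` dominates it and it is in the inner front; kind 5 is the mirror image. -/
theorem not_charge_of_upperLeft {w : Pt} {a b : Fin n} (h : UpperLeft F a b) (c : Fin 6)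
    (ha : Charge F w a c) (hb : Charge F w b c) : False := by
  obtain ⟨h1, h2⟩ := h
  have wa := (F a).width_pos
  have wb := (F b).width_pos
  have va := (F a).height_pos
  have vb := (F b).height_pos
  fin_cases c <;> simp only [Charge] at ha hb
  · linarith [ha.1, ha.2, hb.1, hb.2]
  · linarith
  · obtain ⟨hw, q, ⟨hI, hq⟩, hqw⟩ := hb
    have hwa := ha.1
    have hqb : Dominates (F b).tr q := hq.resolve_left fun hm => by linarith [hm.1]
    exact hI a ⟨by linarith, by linarith [hqb.2]⟩
  · linarith [ha.1, ha.2, hb.1, hb.2]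
  · linarith
  · obtain ⟨hw, q, ⟨hI, hq⟩, hqw⟩ := ha
    have hwb := hb.1
    have hqa : Dominates (F a).tr q := hq.resolve_left fun hm => by linarith [hm.2.2.1]
    exact hI b ⟨by linarith [hqa.1], by linarith⟩

/-- The regions of a finished family that can be charged to one of `m` points are at most `6 * m`. -/
theorem card_le_of_charge (hF : ∀ i, ¬ (F i).region ⊆ IPF Set.univ (original F))
    (hfin : Finished Set.univ (current F P B)) {ι : Type*} (S : Finset (Fin n)) (W : Finset ι)
    (w : ι → Pt) (hS : ∀ a ∈ S, Alive F P B a)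
    (h : ∀ a ∈ S, ∃ i ∈ W, ∃ c, Charge F (w i) a c) : S.card ≤ 6 * W.card := by
  classical
  rcases S.eq_empty_or_nonempty with rfl | ⟨a₀, ha₀⟩
  · simp
  have : Nonempty ι := ⟨(h a₀ ha₀).choose⟩
  choose! i hi c hc using h
  have : S.card ≤ (W ×ˢ (Finset.univ : Finset (Fin 6))).card := by
    refine Finset.card_le_card_of_injOn (fun a => (i a, c a)) (fun a ha => ?_) ?_
    · simpa using hi a ha
    · intro a ha b hb hab
      obtain ⟨e1, e2⟩ := Prod.ext_iff.1 hab
      simp only at e1 e2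
      by_contra hne
      have ca := hc a ha
      have cb := hc b hb
      rw [← e1, ← e2] at cb
      rcases upperLeft_or hF hfin (hS a ha) (hS b hb) hne with h | h
      · exact not_charge_of_upperLeft h _ ca cb
      · exact not_charge_of_upperLeft h _ cb ca
  simpa [mul_comm] using this

theorem exists_charge_fst {a : Fin n} {w q : Pt} (hq : Certifies F a q) (hqw : q.1 ≤ w.1)
    (hw : w.1 ≤ (F a).tr.1) : ∃ c, Charge F w a c := by
  rcases lt_or_ge w.1 (F a).bl.1 with h | h
  · exact ⟨2, h, q, hq, hqw⟩
  · rcases hw.lt_or_eq with h' | h'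
    · exact ⟨0, h, h'⟩
    · exact ⟨1, h'⟩

theorem exists_charge_snd {a : Fin n} {w q : Pt} (hq : Certifies F a q) (hqw : q.2 ≤ w.2)
    (hw : w.2 ≤ (F a).tr.2) : ∃ c, Charge F w a c := by
  rcases lt_or_ge w.2 (F a).bl.2 with h | h
  · exact ⟨5, h, q, hq, hqw⟩
  · rcases hw.lt_or_eq with h' | h'
    · exact ⟨3, h, h'⟩
    · exact ⟨4, h'⟩

/-- Let `a` depend on `b` through `q`. If `b` is in `B`, its top-right corner is weakly beyond `q`
but fails to pass that of `a` in some coordinate, and can be charged. If `b` is alive, its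
separation from `a` excludes `q`. Otherwise a retrieved point beyond `b`, and so beyond `q`, is
charged. -/
theorem exists_charge_of_dependent (hF : ∀ i, ¬ (F i).region ⊆ IPF Set.univ (original F))
    (hfin : Finished Set.univ (current F P B)) {a : Fin n} (hdep : a ∈ dependent F)
    (ha : Alive F P B a) :
    ∃ k ∈ B, (∃ c, Charge F (F k).tr a c) ∨ ∃ c, Charge F (P k) a c := by
  obtain ⟨b, hba, q, hqb, hnd, hI, hq⟩ := exists_of_mem_dependent hdep
  have hcert : Certifies F a q := ⟨hI, hq⟩
  by_cases hbB : b ∈ B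
  · refine ⟨b, hbB, Or.inl ?_⟩
    simp only [Dominates, not_and_or, not_lt] at hnd
    rcases hnd with h | h
    · exact exists_charge_fst hcert hqb.2.1 h
    · exact exists_charge_snd hcert hqb.2.2.2 h
  · by_cases hb : Alive F P B b
    · exfalso
      rcases hq with hq | hq
      · have hfin' := hfin
        rw [current_eq_box] at hfin'
        refine disjoint_of_finished lower_le_upper hfin' hba (ha.not_dominates_lower hF)
          (hb.not_dominates_lower hF) ?_ (z := q) ?_ ?_
        · rw [lower, upper, if_neg ha.1, if_neg ha.1]
          exact fun e => (F a).width_pos.ne (congrArg Prod.fst e)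
        · rwa [lower, upper, if_neg ha.1, if_neg ha.1]
        · rwa [lower, upper, if_neg hbB, if_neg hbB]
      · rcases upperLeft_or hF hfin ha hb hba.symm with h | h
        · linarith [h.1, hq.1, hqb.1]
        · linarith [h.2, hq.2, hqb.2.2.1]
    · simp only [Alive, hbB, not_false_eq_true, true_and, not_forall, not_not] at hb
      obtain ⟨k₀, hk₀, hd₀⟩ := hb
      -- Passing to a maximal lower corner makes the chosen point undominated, as its separation
      -- from `a` requires.
      obtain ⟨k, hk, hkk⟩ := exists_maximal Set.univ (lower F P B) (Set.mem_univ k₀)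
      have hkd : Dominates (lower F P B k) (F b).tr := by
        have : Dominates (lower F P B k₀) (F b).tr := by rwa [lower, if_pos hk₀]
        rcases hkk with rfl | h
        · exact this
        · exact h.trans this
      have hkB : k ∈ B := by
        by_contra hkB
        rw [lower, if_neg hkB] at hkd
        exact tr_not_dominated hF b k hkd
      have hka : k ≠ a := by
        rintro rfl
        exact ha.1 hkB
      have e1 : lower F P B k = P k := if_pos hkB
      have e2 : upper F P B k = P k := if_pos hkB
      have hsep := separated_of_finished hF hfin ha hka fun l => by
        rw [e2, ← e1]
        exact hk.2 l trivial
      rw [e1, e2] at hsep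
      rw [e1] at hkd
      refine ⟨k, hkB, Or.inr ?_⟩
      have hw := (F a).width_pos
      have hh := (F a).height_pos
      rcases hsep with h | h
      · exact exists_charge_fst hcert (by linarith [hqb.2.1, hkd.1]) (by linarith [h.1])
      · exact exists_charge_snd hcert (by linarith [hqb.2.2.2, hkd.2]) (by linarith [h.2])

theorem exists_charge_of_aligned {a : Fin n} (h : Aligned F P a) :
    ∃ v ∈ Vtx F P, ∃ c, Charge F (P v) a c := by
  obtain ⟨v, hv, ⟨h1, h2⟩ | ⟨h1, h2⟩⟩ := h
  · rcases h2.lt_or_eq with h2 | h2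
    · exact ⟨v, hv, 0, h1, h2⟩
    · exact ⟨v, hv, 1, h2⟩
  · rcases h2.lt_or_eq with h2 | h2
    · exact ⟨v, hv, 3, h1, h2⟩
    · exact ⟨v, hv, 4, h2⟩

theorem Base.card_le {A : Finset (Fin n)} (h : Base F P A)
    (hF : ∀ i, ¬ (F i).region ⊆ IPF Set.univ (original F))
    (hP : IsRealization Set.univ (original F) P) (hfin : Finished Set.univ (current F P B)) :
    A.card ≤ 92 * B.card := by
  classical
  let D := A.filter (· ∈ dependent F)
  let S := A.filter (· ∈ independent F)
  have hA : A.card = D.card + S.card := by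
    rw [← Finset.card_filter_add_card_filter_not (· ∈ dependent F)]
    congr 2
    ext a
    simp [dependent, S]
  have halive : ∀ a ∈ A, a ∉ B → Alive F P B a := fun a haA haB =>
    ⟨haB, fun k _ => h.undominated a haA k⟩
  -- The disjoint sum provides two points per region of `B`: its top-right corner and its actual
  -- point.
  have hD : (D \ B).card ≤ 6 * (B.disjSum B).card := by
    refine card_le_of_charge hF hfin (D \ B) (B.disjSum B) (Sum.elim (fun k => (F k).tr) P) ?_ ?_
    · intro a ha
      simp only [D, Finset.mem_sdiff, Finset.mem_filter] at ha
      exact halive a ha.1.1 ha.2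
    · intro a ha
      simp only [D, Finset.mem_sdiff, Finset.mem_filter] at ha
      obtain ⟨k, hk, hc | hc⟩ :=
        exists_charge_of_dependent hF hfin ha.1.2 (halive a ha.1.1 ha.2)
      · exact ⟨Sum.inl k, by simpa using hk, hc⟩
      · exact ⟨Sum.inr k, by simpa using hk, hc⟩
  have hS : (S \ B).card ≤ 6 * D.card := by
    refine card_le_of_charge hF hfin (S \ B) D P ?_ ?_
    · intro a ha
      simp only [S, Finset.mem_sdiff, Finset.mem_filter] at ha
      exact halive a ha.1.1 ha.2
    · intro a ha
      simp only [S, Finset.mem_sdiff, Finset.mem_filter] at ha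
      obtain ⟨v, hv, hc⟩ := exists_charge_of_aligned (h.aligned a ha.1.1 ha.1.2)
      exact ⟨v, by simpa [D] using ⟨Vtx_subset hP h.resolved hv, hv.1⟩, hc⟩
  rw [Finset.card_disjSum] at hD
  have h1 : D.card ≤ (D \ B).card + B.card := Finset.card_le_card_sdiff_add_card
  have h2 : S.card ≤ (S \ B).card + B.card := Finset.card_le_card_sdiff_add_card
  -- Thus `D.card ≤ (12 + 1) * B.card` and `S.card ≤ (6 * 13 + 1) * B.card`, and 13 + 79 = 92.
  omega

theorem exists_minRetrievals (F : Fin n → Rect) (P : Fin n → Pt) :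
    ∃ B : Finset (Fin n), B.card = minRetrievals F P ∧ Finished Set.univ (current F P B) := by
  refine Nat.sInf_mem (s := {m | ∃ A : Finset (Fin n), A.card = m ∧
    Finished Set.univ (current F P A)}) ⟨_, Finset.univ, rfl, fun Q Q' hQ hQ' a b => ?_⟩
  have : Q = Q' := funext fun i => by
    rw [eq_of_current hQ (Finset.mem_univ i), eq_of_current hQ' (Finset.mem_univ i)]
  rw [this]

end LowerBound

end ParetoRetrieval

open ParetoRetrieval
theorem corollary5p1 :
    ∃ c : ℕ, ∀ (n : ℕ) (F : Fin n → Rect) (P : Fin n → Pt),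
      (∀ i, ¬ (F i).region ⊆ IPF Set.univ (original F)) →
      IsRealization Set.univ (original F) P →
      -- every execution terminates, and it can only stop in the phase `done`
      (¬ ∃ σ : ℕ → Config n, σ 0 = start ∧ ∀ t, Step F P (σ t) (σ (t + 1))) ∧
      (∀ C, Reachable F P C → C.phase ≠ Phase.done → ∃ C', Step F P C C') ∧
      -- the result is finished, with an instance-optimal number of retrievals
      (∀ A, Reachable F P ⟨Phase.done, A⟩ →
        Finished Set.univ (current F P A) ∧ A.card ≤ c * minRetrievals F P) ∧
      -- in Stage 1, active layers lie on the outer Pareto front of the current dependent regions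
      (∀ i A, Reachable F P ⟨Phase.stage1 i, A⟩ →
        activeLayer F P A i ⊆ OPF (dependent F) (current F P A)) ∧
      -- every region that is retrieved lies on the outer Pareto front of the whole current family
      (∀ C C', Reachable F P C → Step F P C C' →
        ∀ a ∈ C'.retrieved \ C.retrieved, a ∈ OPF Set.univ (current F P C.retrieved)) := by
  refine ⟨92, fun n F P hF hP => ⟨not_exists_infinite_execution, fun C _ => exists_step C, ?_, ?_,
    ?_⟩⟩
  · intro A hA
    obtain ⟨hbase, hcross, hray⟩ := of_reachable_done hF hP hA
    obtain ⟨B, hB, hfin⟩ := exists_minRetrievals F P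
    exact ⟨Final.finished ⟨hF, hP, hbase.resolved, hcross, hray⟩, hB ▸ hbase.card_le hF hP hfin⟩
  · intro i A hA a ha
    exact activeLayer_subset_OPF hF hP (invariant_of_reachable hF hP hA) ha
      (remaining_subset_dependent i ha.1.1)
  · intro C C' hC hstep a ha
    exact retrieved_mem_OPF hF hP (invariant_of_reachable hF hP hC) hstep ha
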